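/- Let $p \ge 0$ be an integer, $U$ an antisymmetric $p\times p$ matrix with integer entries, $\xi\in\mathbb{C}^\times$ a primitive root of unity of order $N\ge 1$, and $\xi^{1/2}$ a fixed square root of $\xi$. Let $$\mathbb{T}_\xi(U)=\mathbb{C}\langle x_1^{\pm1},\dots,x_p^{\pm1}\rangle/(x_ix_j=\xi^{U_{ij}}x_jx_i)$$ be the quantum torus, and for $k\in\mathbb{Z}^p$ let $X^k=\xi^{-\frac12\sum_{i<j}U_{ij}k_ik_j}\,x_1^{k_1}\cdots x_p^{k_p}$ be the normalized monomial. Let $\Lambda\subset\mathbb{Z}^p$ be a submonoid, let $\underline\Lambda=\Lambda-\Lambda$ be the group it generates, and assume that (i) the cone $\mathrm{Cone}(\Lambda)$, i.e. the $\mathbb{R}_{\ge0}$-span of $\Lambda$ in $\mathbb{R}^p$, is closed; (ii) $\Lambda$ is primitive in $\underline\Lambda$: if $ck\in\Lambda$ for some positive integer $c$ and some $k\in\underline\Lambda$, then $k\in\Lambda$. Let $A=\mathbb{A}_\xi(U,\Lambda)$ be the monomial subalgebra of $\mathbb{T}_\xi(U)$, i.e. the $\mathbb{C}$-span of the $X^k$,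 $k\in\Lambda$. Let $Z$ be the center of $A$ and $\widetilde Z$ the field of fractions of $Z$. Then $A$ is a maximal order: $A$ is a domain, and whenever $B$ is a subring of $A\otimes_Z\widetilde Z$ with $A\subset B\subset\{z^{-1}a: a\in A\}$ for some nonzero $z\in Z$, then $B=A$. Moreover, if $\Lambda$ is finitely generated, then $A$ is finitely generated as a module over $Z$. -/

import Mathlib

open scoped TensorProduct

/-- The defining relations of the quantum torus, on the free algebra with one generator `(i, true)`
for each variable `x i` and one generator `(i, false)` for its formal inverse:
`x i * (x i)⁻¹ = 1 = (x i)⁻¹ * x i` and `x i * x j = q ^ (U i j) * x j * x i`. -/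
inductive QuantumTorus.Rel {R : Type*} [CommRing R] {p : ℕ} (U : Matrix (Fin p) (Fin p) ℤ)
    (q : Rˣ) : FreeAlgebra R (Fin p × Bool) → FreeAlgebra R (Fin p × Bool) → Prop
  | mul_inv (i : Fin p) :
      Rel U q (FreeAlgebra.ι R (i, true) * FreeAlgebra.ι R (i, false)) 1
  | inv_mul (i : Fin p) :
      Rel U q (FreeAlgebra.ι R (i, false) * FreeAlgebra.ι R (i, true)) 1
  | comm (i j : Fin p) :
      Rel U q (FreeAlgebra.ι R (i, true) * FreeAlgebra.ι R (j, true))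
        (((q ^ U i j : Rˣ) : R) • (FreeAlgebra.ι R (j, true) * FreeAlgebra.ι R (i, true)))

/-- The quantum torus `R⟨x_i^{±1}⟩ / (x_i x_j = q^{U_ij} x_j x_i)`. -/
def QuantumTorus {R : Type*} [CommRing R] {p : ℕ} (U : Matrix (Fin p) (Fin p) ℤ) (q : Rˣ) :
    Type _ :=
  RingQuot (QuantumTorus.Rel U q)

namespace QuantumTorus

variable {R : Type*} [CommRing R] {p : ℕ} (U : Matrix (Fin p) (Fin p) ℤ) (q : Rˣ)

instance : Ring (QuantumTorus U q) := inferInstanceAs (Ring (RingQuot (Rel U q)))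

instance : Algebra R (QuantumTorus U q) := inferInstanceAs (Algebra R (RingQuot (Rel U q)))

/-- The quotient map from the free algebra. -/
def mk : FreeAlgebra R (Fin p × Bool) →ₐ[R] QuantumTorus U q :=
  RingQuot.mkAlgHom R (Rel U q)

theorem mk_rel {a b : FreeAlgebra R (Fin p × Bool)} (h : Rel U q a b) : mk U q a = mk U q b :=
  RingQuot.mkAlgHom_rel R h

/-- The basis variable `x i`, as a unit of the quantum torus. -/
def x (i : Fin p) : (QuantumTorus U q)ˣ where
  val := mk U q (FreeAlgebra.ι R (i, true))
  inv := mk U q (FreeAlgebra.ι R (i, false))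
  val_inv := by rw [← map_mul, mk_rel U q (Rel.mul_inv i), map_one]
  inv_val := by rw [← map_mul, mk_rel U q (Rel.inv_mul i), map_one]

/-- An invertible scalar, as a unit of the quantum torus. -/
def scalar (c : Rˣ) : (QuantumTorus U q)ˣ :=
  Units.map (algebraMap R (QuantumTorus U q)).toMonoidHom c

/-- The normalized monomial `X^k`: the Weyl normalization
`q^{-(1/2) ∑_{i<j} U_ij k_i k_j} x_1^{k_1} ⋯ x_p^{k_p}`, where `qHalf` plays the role of `q^{1/2}`.
(Recall that `x_i^{k_i} x_j^{k_j} = q^{U_ij k_i k_j} x_j^{k_j} x_i^{k_i}`.) -/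
def X (qHalf : Rˣ) (k : Fin p → ℤ) : QuantumTorus U q :=
  ((qHalf ^ (-∑ i, ∑ j ∈ Finset.Ioi i, U i j * k i * k j) : Rˣ) : R) •
    (((List.finRange p).map fun i => x U q i ^ k i).prod : (QuantumTorus U q)ˣ)

variable {U q}

/-- The product of two normalized monomials is a scalar multiple of the normalized monomial of the
sum of the exponents. -/
theorem X_mul_X (qHalf : Rˣ) (k n : Fin p → ℤ) :
    ∃ c : R, X U q qHalf k * X U q qHalf n = c • X U q qHalf (k + n) := by
  let σ : Rˣ →* (QuantumTorus U q)ˣ := Units.map (algebraMap R (QuantumTorus U q)).toMonoidHom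
  have hσ : ∀ c a, a * σ c = σ c * a := fun c a =>
    Units.ext (Algebra.commutes (c : R) (a : QuantumTorus U q)).symm
  have : σ.range.Normal := ⟨by
    rintro _ ⟨c, rfl⟩ g
    exact ⟨c, by rw [hσ, mul_inv_cancel_right]⟩⟩
  let π := QuotientGroup.mk' σ.range
  have hcomm : ∀ i j, Commute (π (x U q i)) (π (x U q j)) := by
    intro i j
    have h : x U q i * x U q j = x U q j * x U q i * σ (q ^ U i j) := by
      rw [hσ]
      ext
      have := mk_rel U q (Rel.comm i j)
      rw [map_mul, map_smul, map_mul, Algebra.smul_def] at this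
      exact this
    change π _ * π _ = π _ * π _
    rw [← map_mul, ← map_mul]
    exact (QuotientGroup.eq.mpr (MonoidHom.mem_range.mpr ⟨q ^ U i j, by rw [h]; group⟩)).symm
  have hprod : ∀ l : List (Fin p),
      π ((l.map fun i => x U q i ^ (k + n) i).prod) =
        π ((l.map fun i => x U q i ^ k i).prod) * π ((l.map fun i => x U q i ^ n i).prod) := by
    intro l
    induction l with
    | nil => simp
    | cons i l ih =>
      have hc : Commute (π (x U q i ^ n i)) (π ((l.map fun i => x U q i ^ k i).prod)) := by
        rw [map_list_prod]
        apply Commute.list_prod_right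
        simp only [List.map_map, List.mem_map, Function.comp]
        rintro _ ⟨j, -, rfl⟩
        rw [map_zpow, map_zpow]
        exact (hcomm i j).zpow_zpow _ _
      rw [List.map_cons, List.prod_cons, map_mul, ih]
      simp only [List.map_cons, List.prod_cons, map_mul, Pi.add_apply, zpow_add]
      simp only [mul_assoc]
      rw [← mul_assoc (π (x U q i ^ n i)), hc.eq, mul_assoc]
  obtain ⟨c, hc⟩ := QuotientGroup.eq.mp ((hprod (List.finRange p)).trans (map_mul π _ _).symm)
  rw [eq_inv_mul_iff_mul_eq] at hc
  replace hc := congrArg Units.val hc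
  rw [hσ, Units.val_mul, Units.val_mul] at hc
  change algebraMap R _ (c : R) * _ = _ at hc
  rw [← Algebra.smul_def] at hc
  unfold X
  rw [smul_mul_smul_comm, ← hc, smul_smul]
  generalize ((List.finRange p).map fun i => x U q i ^ (k + n) i).prod = P
  generalize (qHalf ^ (-∑ i, ∑ j ∈ Finset.Ioi i, U i j * (k + n) i * (k + n) j) : Rˣ) = d
  generalize (_ * (c : R) : R) = e
  exact ⟨e * (d⁻¹ : Rˣ), by rw [smul_smul, mul_assoc, Units.inv_mul, mul_one]⟩

theorem X_zero (qHalf : Rˣ) : X U q qHalf 0 = 1 := by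
  simp [X]

variable (U q)

/-- The monomial subalgebra `A(Λ)`: the linear span of the normalized monomials `X^k`, `k ∈ Λ`. -/
def monomialSubalgebra (qHalf : Rˣ) (Λ : AddSubmonoid (Fin p → ℤ)) :
    Subalgebra R (QuantumTorus U q) :=
  (Submodule.span R (X U q qHalf '' (Λ : Set (Fin p → ℤ)))).toSubalgebra
    (Submodule.subset_span ⟨0, Λ.zero_mem, X_zero qHalf⟩)
    (by
      intro a b ha hb
      have h := Submodule.mul_mem_mul ha hb
      rw [Submodule.span_mul_span] at h
      refine Submodule.span_le.mpr ?_ h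
      rintro _ ⟨_, ⟨k, hk, rfl⟩, _, ⟨n, hn, rfl⟩, rfl⟩
      obtain ⟨c, hc⟩ := X_mul_X (U := U) (q := q) qHalf k n
      change X U q qHalf k * X U q qHalf n ∈ _
      rw [hc]
      exact Submodule.smul_mem _ _ (Submodule.subset_span ⟨k + n, Λ.add_mem hk hn, rfl⟩))

end QuantumTorus

/-- The cone of a submonoid of `ℤ^p`: its `ℝ_{≥ 0}`-span in `ℝ^p`. -/
def latticeCone {p : ℕ} (Λ : AddSubmonoid (Fin p → ℤ)) : PointedCone ℝ (Fin p → ℝ) :=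
  PointedCone.hull ℝ ((fun (k : Fin p → ℤ) (i : Fin p) => (k i : ℝ)) '' (Λ : Set (Fin p → ℤ)))

/-- `Λ` is primitive in the group `Λ - Λ` it generates: if `c k ∈ Λ` for a positive integer `c`
and a `k` in that group, then `k ∈ Λ`. -/
def IsPrimitiveSubmonoid {p : ℕ} (Λ : AddSubmonoid (Fin p → ℤ)) : Prop :=
  ∀ c : ℕ, 0 < c → ∀ k ∈ AddSubgroup.closure (Λ : Set (Fin p → ℤ)), c • k ∈ Λ → k ∈ Λ

/-- With `Z` the center of `A` and `Frac Z` its ring of fractions, this is `A ⊗_Z Frac Z`. -/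
abbrev CentralLocalization (A : Type*) [Ring A] : Type _ :=
  A ⊗[Subring.center A] FractionRing (Subring.center A)

/-- The canonical map `A → A ⊗_Z Frac Z`. -/
def CentralLocalization.of (A : Type*) [Ring A] : A →+* CentralLocalization A :=
  (Algebra.TensorProduct.includeLeft :
    A →ₐ[Subring.center A] A ⊗[Subring.center A] FractionRing (Subring.center A)).toRingHom

/-- The set `(z⁻¹)A = {z⁻¹ a : a ∈ A}` inside `A ⊗_Z Frac Z`, for a regular element `z` of the
center `Z` (in a domain: for a nonzero `z`). -/
def CentralLocalization.fractions {A : Type*} [Ring A]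
    (z : nonZeroDivisors (Subring.center A)) : Set (CentralLocalization A) :=
  Set.range fun a : A =>
    a ⊗ₜ[Subring.center A] IsLocalization.mk' (FractionRing (Subring.center A)) 1 z

/-- A domain `A` with center `Z` is a maximal order if every subring `B` of `A ⊗_Z Frac Z` with
`A ⊆ B ⊆ (z⁻¹)A` for some nonzero `z ∈ Z` equals `A`. -/
structure IsMaximalOrder (A : Type*) [Ring A] : Prop where
  isDomain : IsDomain A
  eq_of_le : ∀ (B : Subring (CentralLocalization A)) (z : nonZeroDivisors (Subring.center A)),
    (CentralLocalization.of A).range ≤ B →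
    (B : Set (CentralLocalization A)) ⊆ CentralLocalization.fractions z →
    B = (CentralLocalization.of A).range

/-! ### Commutative case: Laurent polynomial rings up to scalars, and almost integral elements. -/

namespace TwistedMonomial

/-! Let `A ⊆ B ⊆ z⁻¹A`. The numerators `I = {a ∈ A : z⁻¹a ∈ B}` form a two-sided ideal with `I * I ⊆
z * I`, and `B = A` amounts to `I ⊆ z * A`. This is proved inside the torus, where monomials form a
basis multiplicative up to a bicharacter `β` with values in the `N`-th roots of unity; only this
structure (`IsTwistedBasis`) is used.

Closedness of the cone and primitivity say that `Λ` is the intersection of its group `L` with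
half-spaces `0 ≤ f` (`mem_of_forall_nonneg`), so the claim splits in two.

Over the group: inverting the central monomials `Y (N • m)` turns `I` into a bimodule `J` over the
torus of `L`, still with `J * J ⊆ z * J`. Conjugation by monomials is diagonal with `N`-th roots of
unity as eigenvalues, so averaging shows that `J` is graded by `L` modulo its radical
(`proj_coset_mem`). A homogeneous element is a monomial times some `s` in the torus of the radical,
a Noetherian normal commutative domain that also contains `z`. Iterating `J * J ⊆ z * J` makes `s /
z` almost integral, hence integral, hence an element of that ring (`dvd_of_symmetric`). So every `x
∈ I` is `z * b` with `b` in the torus of `L`.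

Over the half-spaces: `z * b ^ n` lies in `A` for all `n`. Minima of `f` over supports add under
multiplication, so a negative minimum on `b` would eventually contradict `f ≥ 0` on `Λ`
(`nonneg_of_forall_mul_pow`). Hence `b ∈ A`.

Finiteness over the center is division with remainder by `N` in the exponents. -/

open MvPolynomial in
/-- A commutative domain with a basis of monomials, indexed by a finitely generated free abelian
group and multiplicative up to units, is a localization of a polynomial ring, hence Noetherian and
integrally closed. -/
theorem isNoetherianRing_and_isIntegrallyClosed {K S H : Type*} [Field K] [CommRing S] [IsDomain S]
    [Algebra K S] [AddCommGroup H] [Module.Free ℤ H] [Module.Finite ℤ H] (y : H → S)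
    (hli : LinearIndependent K y) (hsp : Submodule.span K (Set.range y) = ⊤)
    (hmul : ∀ k l, ∃ c : Kˣ, y k * y l = c • y (k + l)) :
    IsNoetherianRing S ∧ IsIntegrallyClosed S := by
  classical
  have hy0 : ∃ c : Kˣ, y 0 = c • (1 : S) := by
    obtain ⟨c, hc⟩ := hmul 0 0
    refine ⟨c, mul_right_cancel₀ (hli.ne_zero 0) ?_⟩
    rw [hc, add_zero, smul_mul_assoc, one_mul]
  have hunit : ∀ k, IsUnit (y k) := by
    intro k
    obtain ⟨c, hc⟩ := hmul k (-k)
    obtain ⟨e, he⟩ := hy0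
    refine IsUnit.of_mul_eq_one ((c * e)⁻¹ • y (-k)) ?_
    rw [mul_smul_comm, hc, add_neg_cancel, he, smul_smul, smul_smul, mul_assoc,
      inv_mul_cancel, one_smul]
  let b := Module.Free.chooseBasis ℤ H
  let ι := Module.Free.ChooseBasisIndex ℤ H
  let d : (ι →₀ ℕ) →+ H := (Finsupp.linearCombination ℕ b).toAddMonoidHom
  have hd_single : ∀ i, d (Finsupp.single i 1) = b i := fun i => by simp [d]
  have hd_repr : ∀ (m : ι →₀ ℕ) (i : ι), b.repr (d m) i = m i := by
    intro m
    induction m using Finsupp.induction_linear with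
    | zero => simp
    | add f g hf hg => intro i; simp [hf, hg]
    | single j n =>
      intro i
      have : d (Finsupp.single j n) = (n : ℤ) • b j := by simp [d]
      rw [this, map_smul, Finsupp.smul_apply, Module.Basis.repr_self]
      by_cases h : j = i
      · subst h; simp
      · simp [Finsupp.single_eq_of_ne' h]
  have hd_inj : Function.Injective d := fun m n h => by
    ext i
    have := hd_repr m i
    rw [h, hd_repr n i] at this
    exact_mod_cast this.symm
  -- Positive and negative parts of the coordinates of `k`.
  have hd_sub : ∀ k : H, ∃ m n, k + d n = d m := by
    intro k
    refine ⟨(b.repr k).mapRange Int.toNat (by simp),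
      (b.repr k).mapRange (fun t => (-t).toNat) (by simp), b.repr.injective ?_⟩
    ext i
    rw [map_add, Finsupp.add_apply, hd_repr, hd_repr, Finsupp.mapRange_apply,
      Finsupp.mapRange_apply]
    omega
  let f : MvPolynomial ι K →ₐ[K] S := aeval fun i => y (b i)
  have hf : ∀ m : ι →₀ ℕ, ∃ c : Kˣ, f (monomial m 1) = c • y (d m) := by
    intro m
    induction m using Finsupp.induction_linear with
    | zero =>
      obtain ⟨e, he⟩ := hy0
      refine ⟨e⁻¹, ?_⟩
      rw [map_zero, he, smul_smul, inv_mul_cancel, one_smul]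
      exact map_one f
    | add m n hm hn =>
      obtain ⟨c, hc⟩ := hm
      obtain ⟨e, he⟩ := hn
      obtain ⟨t, ht⟩ := hmul (d m) (d n)
      refine ⟨c * e * t, ?_⟩
      have h1 : monomial (m + n) (1 : K) = monomial m 1 * monomial n 1 := by
        rw [monomial_mul, one_mul]
      rw [h1, map_mul, hc, he, smul_mul_smul_comm, ht, map_add, smul_smul]
    | single i n =>
      induction n with
      | zero =>
        obtain ⟨e, he⟩ := hy0
        refine ⟨e⁻¹, ?_⟩
        rw [Finsupp.single_zero, map_zero, he, smul_smul, inv_mul_cancel, one_smul]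
        exact map_one f
      | succ n ih =>
        obtain ⟨c, hc⟩ := ih
        obtain ⟨t, ht⟩ := hmul (d (Finsupp.single i n)) (d (Finsupp.single i 1))
        refine ⟨c * t, ?_⟩
        have h1 : monomial (Finsupp.single i (n + 1)) (1 : K) =
            monomial (Finsupp.single i n) 1 * X i := by
          rw [X, monomial_mul, one_mul, ← Finsupp.single_add]
        have h2 : f (X i) = y (d (Finsupp.single i 1)) := by
          rw [hd_single]; exact aeval_X _ _
        rw [h1, map_mul, hc, h2, smul_mul_assoc, ht, Finsupp.single_add, map_add, smul_smul]
  choose c hc using hf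
  have hfinj : Function.Injective f := by
    have hli' : LinearIndependent K fun m => f (monomial m 1) := by
      have := (hli.comp d hd_inj).units_smul c
      convert this using 1
      ext m
      exact hc m
    rw [injective_iff_map_eq_zero]
    intro p hp
    have h1 := p.support_sum_monomial_coeff
    rw [← h1, map_sum] at hp
    have h2 : ∀ m, f (monomial m (coeff m p)) = coeff m p • f (monomial m 1) := fun m => by
      rw [← map_smul, smul_monomial, smul_eq_mul, mul_one]
    simp_rw [h2] at hp
    have h3 := linearIndependent_iff'.mp hli' p.support (fun m => coeff m p) hp
    ext m
    by_cases hm : m ∈ p.support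
    · exact h3 m hm
    · simpa using hm
  let : Algebra (MvPolynomial ι K) S := f.toRingHom.toAlgebra
  -- Inverting everything that becomes a unit in `S` suffices: `M` contains all monomials, and some
  -- monomial carries any given element of `S` into the range of `f`.
  let M : Submonoid (MvPolynomial ι K) := (IsUnit.submonoid S).comap f
  have hM : M ≤ nonZeroDivisors (MvPolynomial ι K) := by
    intro x hx
    rw [mem_nonZeroDivisors_iff_ne_zero]
    rintro rfl
    have : IsUnit (f 0) := hx
    rw [map_zero] at this
    exact not_isUnit_zero this
  have hmonM : ∀ m, monomial m (1 : K) ∈ M := by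
    intro m
    change IsUnit (f _)
    rw [hc]
    exact (hunit _).smul _
  have hsurj : ∀ s : S, ∃ m, s * f (monomial m 1) ∈ f.range := by
    intro s
    have hs : s ∈ Submodule.span K (Set.range y) := hsp ▸ Submodule.mem_top
    induction hs using Submodule.span_induction with
    | mem s hs =>
      obtain ⟨k, rfl⟩ := hs
      obtain ⟨m, n, h⟩ := hd_sub k
      refine ⟨n, ?_⟩
      obtain ⟨e, he⟩ := hmul k (d n)
      have h1 : y (d m) ∈ f.range := by
        have : y (d m) = ((c m)⁻¹ : Kˣ) • f (monomial m 1) := by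
          rw [hc, smul_smul, inv_mul_cancel, one_smul]
        rw [this]
        exact f.range.smul_mem ⟨_, rfl⟩ _
      rw [hc, mul_smul_comm, he, h, smul_smul]
      exact f.range.smul_mem h1 _
    | zero => exact ⟨0, by simp⟩
    | add s t _ _ hs ht =>
      obtain ⟨m, hm⟩ := hs
      obtain ⟨n, hn⟩ := ht
      refine ⟨m + n, ?_⟩
      have h1 : monomial (m + n) (1 : K) = monomial m 1 * monomial n 1 := by
        rw [monomial_mul, one_mul]
      rw [h1, map_mul, add_mul]
      refine add_mem ?_ ?_
      · rw [← mul_assoc]; exact mul_mem hm ⟨_, rfl⟩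
      · rw [mul_left_comm]; exact mul_mem ⟨_, rfl⟩ hn
    | smul a s _ hs =>
      obtain ⟨m, hm⟩ := hs
      exact ⟨m, by rw [smul_mul_assoc]; exact f.range.smul_mem hm _⟩
  have : IsLocalization M S :=
    { map_units := fun x => x.2
      surj := fun s => by
        obtain ⟨m, p, hp⟩ := hsurj s
        exact ⟨(p, ⟨_, hmonM m⟩), hp.symm⟩
      exists_of_eq := fun {x z} h => ⟨1, by rw [hfinj h]⟩ }
  exact ⟨IsLocalization.isNoetherianRing M S inferInstance,
    isIntegrallyClosed_of_isLocalization S M hM⟩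

/-- The hypothesis says `z * (s / z) ^ n ∈ S` for all `n`, so `s / z` is almost integral; over a
Noetherian ring it is then integral, and normality puts it in `S`. -/
theorem dvd_of_forall_pow_dvd {S : Type*} [CommRing S] [IsDomain S] [IsNoetherianRing S]
    [IsIntegrallyClosed S] {z s : S} (hz : z ≠ 0) (h : ∀ n : ℕ, z ^ n ∣ z * s ^ n) : z ∣ s := by
  let F := FractionRing S
  have hz' : algebraMap S F z ≠ 0 := by
    rwa [Ne, FaithfulSMul.algebraMap_eq_zero_iff]
  have hint : IsIntegral S (algebraMap S F s / algebraMap S F z) := by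
    refine IsAlmostIntegral.isIntegral ⟨z, mem_nonZeroDivisors_of_ne_zero hz, fun n => ?_⟩
    obtain ⟨t, ht⟩ := h n
    refine ⟨t, ?_⟩
    have := congrArg (algebraMap S F) ht
    simp only [map_mul, map_pow] at this
    rw [Algebra.smul_def, div_pow, mul_div_assoc', this, mul_div_assoc,
      mul_div_cancel₀]
    exact pow_ne_zero _ hz'
  obtain ⟨t, ht⟩ := IsIntegrallyClosed.isIntegral_iff.mp hint
  refine ⟨t, FaithfulSMul.algebraMap_injective S F ?_⟩
  rw [map_mul, ht, mul_div_cancel₀ _ hz']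

end TwistedMonomial

/-! ### Twisted bases: bicharacter calculus and supports of products. -/

/-- A basis `Y` of a `K`-algebra indexed by an abelian group, with
`Y k * Y l = β k l • Y (k + l)` for a bicharacter `β` of exponent dividing `N`. -/
structure IsTwistedBasis {K T G : Type*} [Field K] [Ring T] [Algebra K T] [AddCommGroup G]
    (Y : Module.Basis G K T) (β : G → G → Kˣ) (N : ℕ) : Prop where
  mul (k l : G) : Y k * Y l = β k l • Y (k + l)
  add_left (k k' l : G) : β (k + k') l = β k l * β k' l
  add_right (k l l' : G) : β k (l + l') = β k l * β k l'
  pow_eq_one (k l : G) : β k l ^ N = 1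

namespace IsTwistedBasis

variable {K T G : Type*} [Field K] [Ring T] [Algebra K T] [AddCommGroup G]
  {Y : Module.Basis G K T} {β : G → G → Kˣ} {N : ℕ}

section Bicharacter

variable (h : IsTwistedBasis Y β N)
include h

theorem zero_left (l : G) : β 0 l = 1 := by
  have := h.add_left 0 0 l
  rwa [add_zero, left_eq_mul] at this

theorem zero_right (k : G) : β k 0 = 1 := by
  have := h.add_right k 0 0
  rwa [add_zero, left_eq_mul] at this

theorem neg_left (k l : G) : β (-k) l = (β k l)⁻¹ := by
  rw [eq_inv_iff_mul_eq_one, ← h.add_left, neg_add_cancel, h.zero_left]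

theorem neg_right (k l : G) : β k (-l) = (β k l)⁻¹ := by
  rw [eq_inv_iff_mul_eq_one, ← h.add_right, neg_add_cancel, h.zero_right]

theorem nsmul_left (n : ℕ) (k l : G) : β (n • k) l = β k l ^ n := by
  induction n with
  | zero => rw [zero_smul, h.zero_left, pow_zero]
  | succ n ih => rw [succ_nsmul, h.add_left, ih, pow_succ]

theorem nsmul_right (n : ℕ) (k l : G) : β k (n • l) = β k l ^ n := by
  induction n with
  | zero => rw [zero_smul, h.zero_right, pow_zero]
  | succ n ih => rw [succ_nsmul, h.add_right, ih, pow_succ]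

theorem one_eq : Y 0 = 1 := by
  have h1 : LinearMap.mulLeft K (Y 0) = LinearMap.id := Y.ext fun k => by
    rw [LinearMap.mulLeft_apply, h.mul, h.zero_left, one_smul, zero_add, LinearMap.id_apply]
  have := congrArg (fun f => f 1) h1
  simpa using this

theorem mul_nsmul (m l : G) : Y l * Y (N • m) = Y (l + N • m) := by
  rw [h.mul, h.nsmul_right, h.pow_eq_one, one_smul]

theorem nsmul_mul (m l : G) : Y (N • m) * Y l = Y (N • m + l) := by
  rw [h.mul, h.nsmul_left, h.pow_eq_one, one_smul]

/-- Values of `β` are `N`-th roots of unity, so twists against `N • m` are trivial. These central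
monomials serve as denominators in `saturation` and as coefficients in the finiteness statement. -/
theorem commute_nsmul (m : G) (x : T) : Commute (Y (N • m)) x := by
  have h1 : LinearMap.mulLeft K (Y (N • m)) = LinearMap.mulRight K (Y (N • m)) := Y.ext fun k => by
    rw [LinearMap.mulLeft_apply, LinearMap.mulRight_apply, h.nsmul_mul, h.mul_nsmul, add_comm]
  exact congrArg (fun f => f x) h1

theorem mul_comm_smul (k l : G) : Y k * Y l = (β k l * (β l k)⁻¹) • (Y l * Y k) := by
  rw [h.mul, h.mul l k, smul_smul, inv_mul_cancel_right, add_comm]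

theorem mul_neg (k : G) : Y k * Y (-k) = (β k k)⁻¹ • (1 : T) := by
  rw [h.mul, h.neg_right, add_neg_cancel, h.one_eq]

theorem neg_mul (k : G) : Y (-k) * Y k = (β k k)⁻¹ • (1 : T) := by
  rw [h.mul, h.neg_left, neg_add_cancel, h.one_eq]

theorem repr_mul (x y : T) (m : G) :
    Y.repr (x * y) m = (Y.repr x).sum fun k c => c * (β k (m - k) * Y.repr y (m - k)) := by
  have hy : ∀ k, Y.repr (Y k * y) m = β k (m - k) * Y.repr y (m - k) := by
    intro k
    induction Y.mem_span y using Submodule.span_induction with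
    | mem y hy =>
      obtain ⟨l, rfl⟩ := hy
      rw [h.mul, Units.smul_def, map_smul, Finsupp.smul_apply, Y.repr_self, Y.repr_self]
      by_cases hl : k + l = m
      · subst hl; simp
      · have : l ≠ m - k := fun h' => hl (by rw [h', add_sub_cancel])
        rw [Finsupp.single_eq_of_ne' hl, Finsupp.single_eq_of_ne' this]; simp
    | zero => simp
    | add x y _ _ hx hy => rw [mul_add, map_add, Finsupp.add_apply, hx, hy, map_add,
        Finsupp.add_apply, mul_add]
    | smul c x _ hx => rw [mul_smul_comm, map_smul, Finsupp.smul_apply, hx, map_smul,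
        Finsupp.smul_apply, smul_eq_mul, smul_eq_mul, mul_left_comm]
  conv_lhs => rw [← Y.linearCombination_repr x]
  rw [Finsupp.linearCombination_apply, Finsupp.sum, Finset.sum_mul, map_sum,
    Finsupp.finsetSum_apply, Finsupp.sum]
  refine Finset.sum_congr rfl fun k _ => ?_
  rw [smul_mul_assoc, map_smul, Finsupp.smul_apply, hy, smul_eq_mul]

theorem exists_of_mem_support_mul {x y : T} {m : G} (hm : Y.repr (x * y) m ≠ 0) :
    ∃ k l, Y.repr x k ≠ 0 ∧ Y.repr y l ≠ 0 ∧ k + l = m := by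
  rw [h.repr_mul] at hm
  obtain ⟨k, _, hk⟩ := Finset.exists_ne_zero_of_sum_ne_zero hm
  exact ⟨k, m - k, left_ne_zero_of_mul hk, right_ne_zero_of_mul (right_ne_zero_of_mul hk),
    add_sub_cancel k m⟩

/-- Minimal values of an additive function on supports add up in products. -/
theorem exists_minimum_mul [UniqueSums G] (f : G →+ ℝ) {x y : T} {kx ky : G}
    (hx : Y.repr x kx ≠ 0) (hx' : ∀ k, Y.repr x k ≠ 0 → f kx ≤ f k)
    (hy : Y.repr y ky ≠ 0) (hy' : ∀ k, Y.repr y k ≠ 0 → f ky ≤ f k) :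
    ∃ m, Y.repr (x * y) m ≠ 0 ∧ (∀ k, Y.repr (x * y) k ≠ 0 → f m ≤ f k) ∧ f m = f kx + f ky := by
  classical
  -- `A` and `B` are the faces of the supports where `f` is minimal. A sum `a + b` attained only
  -- once on `A × B` is attained only once on the full supports, since any other pair has a larger
  -- value of `f`; so its coefficient cannot cancel.
  let A := (Y.repr x).support.filter fun k => f k = f kx
  let B := (Y.repr y).support.filter fun k => f k = f ky
  obtain ⟨a, ha, b, hb, hab⟩ := UniqueSums.uniqueAdd_of_nonempty (A := A) (B := B)
    ⟨kx, by simp [A, hx]⟩ ⟨ky, by simp [B, hy]⟩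
  simp only [A, B, Finset.mem_filter, Finsupp.mem_support_iff] at ha hb
  refine ⟨a + b, ?_, ?_, by rw [map_add, ha.2, hb.2]⟩
  · rw [h.repr_mul, Finsupp.sum, Finset.sum_eq_single a]
    · rw [add_sub_cancel_left]
      exact mul_ne_zero ha.1 (mul_ne_zero (Units.ne_zero _) hb.1)
    · intro k hk hka
      by_contra hne
      rw [Finsupp.mem_support_iff] at hk
      have hl := right_ne_zero_of_mul (right_ne_zero_of_mul hne)
      have h1 := hx' k hk
      have h2 := hy' _ hl
      have h3 : f k + f (a + b - k) = f kx + f ky := by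
        rw [← map_add, add_sub_cancel, map_add, ha.2, hb.2]
      refine hka (hab (a := k) (b := a + b - k) ?_ ?_ (add_sub_cancel _ _)).1
      · simp only [A, Finset.mem_filter, Finsupp.mem_support_iff]
        exact ⟨hk, by linarith⟩
      · simp only [B, Finset.mem_filter, Finsupp.mem_support_iff]
        exact ⟨hl, by linarith⟩
    · intro hna
      exact absurd (Finsupp.mem_support_iff.mpr ha.1) hna
  · intro k hk
    obtain ⟨i, j, hi, hj, rfl⟩ := h.exists_of_mem_support_mul hk
    rw [map_add, map_add, ha.2, hb.2]
    exact add_le_add (hx' i hi) (hy' j hj)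

end Bicharacter

theorem exists_minimum (f : G →+ ℝ) {x : T} (hx : x ≠ 0) :
    ∃ k, Y.repr x k ≠ 0 ∧ ∀ l, Y.repr x l ≠ 0 → f k ≤ f l := by
  have hne : (Y.repr x).support.Nonempty := by
    rw [Finsupp.support_nonempty_iff]
    simpa using hx
  obtain ⟨k, hk, hk'⟩ := Finset.exists_min_image _ f hne
  exact ⟨k, by simpa using hk, fun l hl => hk' l (by simpa using hl)⟩

/-- For `f = 0` every support point is minimal, so `exists_minimum_mul` just says that a product of
nonzero elements has nonempty support. -/
theorem noZeroDivisors [UniqueSums G] (h : IsTwistedBasis Y β N) : NoZeroDivisors T where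
  eq_zero_or_eq_zero_of_mul_eq_zero {x y} hxy := by
    by_contra! hne
    obtain ⟨k, hk, hk'⟩ := exists_minimum (Y := Y) 0 hne.1
    obtain ⟨l, hl, hl'⟩ := exists_minimum (Y := Y) 0 hne.2
    obtain ⟨m, hm, -⟩ := h.exists_minimum_mul 0 hk hk' hl hl'
    rw [hxy, map_zero] at hm
    exact hm rfl

/-- If `z * y ^ n` is supported in the half-space `0 ≤ f` for all `n`, so is `y`. -/
theorem nonneg_of_forall_mul_pow [UniqueSums G] (h : IsTwistedBasis Y β N) (f : G →+ ℝ) {z y : T}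
    (hz : z ≠ 0) (hzy : ∀ n : ℕ, ∀ k, Y.repr (z * y ^ n) k ≠ 0 → 0 ≤ f k)
    {k : G} (hk : Y.repr y k ≠ 0) : 0 ≤ f k := by
  have hy : y ≠ 0 := by
    rintro rfl
    simp at hk
  obtain ⟨kz, hkz, hkz'⟩ := exists_minimum (Y := Y) f hz
  obtain ⟨ky, hky, hky'⟩ := exists_minimum (Y := Y) f hy
  have key : ∀ n : ℕ, ∃ m, Y.repr (z * y ^ n) m ≠ 0 ∧
      (∀ k, Y.repr (z * y ^ n) k ≠ 0 → f m ≤ f k) ∧ f m = f kz + n * f ky := by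
    intro n
    induction n with
    | zero => exact ⟨kz, by simpa using hkz, by simpa using hkz', by simp⟩
    | succ n ih =>
      obtain ⟨m, hm, hm', hfm⟩ := ih
      obtain ⟨l, hl, hl', hfl⟩ := h.exists_minimum_mul f hm hm' hky hky'
      refine ⟨l, ?_, ?_, ?_⟩
      · rwa [pow_succ, ← mul_assoc]
      · rwa [pow_succ, ← mul_assoc]
      · rw [hfl, hfm]; push_cast; ring
  refine le_trans ?_ (hky' k hk)
  by_contra! hneg
  -- For such `n` the minimum `f kz + n * f ky` on the support of `z * y ^ n` is negative.
  obtain ⟨n, hn⟩ := exists_nat_gt (f kz / -f ky)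
  obtain ⟨m, hm, -, hfm⟩ := key n
  have := hzy n m hm
  rw [div_lt_iff₀ (by linarith)] at hn
  linarith

end IsTwistedBasis

/-! ### Projections to sets of exponents, monomial subalgebras and the radical. -/

namespace IsTwistedBasis

variable {K T G : Type*} [Field K] [Ring T] [Algebra K T] {Y : Module.Basis G K T}

theorem mem_span_image_iff {x : T} {S : Set G} :
    x ∈ Submodule.span K (Y '' S) ↔ ∀ k, Y.repr x k ≠ 0 → k ∈ S := by
  rw [Y.mem_span_image]
  exact ⟨fun h k hk => h (by simpa using hk), fun h k hk => h k (by simpa using hk)⟩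

open Classical in
/-- The projection that keeps the monomials whose exponents satisfy `P`. -/
noncomputable def proj (Y : Module.Basis G K T) (P : G → Prop) : T →ₗ[K] T :=
  Y.constr K fun k => if P k then Y k else 0

open Classical in
theorem proj_basis (P : G → Prop) (k : G) : proj Y P (Y k) = if P k then Y k else 0 :=
  Y.constr_basis K _ k

open Classical in
theorem repr_proj (P : G → Prop) (x : T) (k : G) :
    Y.repr (proj Y P x) k = if P k then Y.repr x k else 0 := by
  induction Y.mem_span x using Submodule.span_induction with
  | mem x hx =>
    obtain ⟨l, rfl⟩ := hx
    rw [proj_basis]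
    by_cases hkl : l = k
    · subst hkl; split_ifs <;> simp
    · rw [Y.repr_self, Finsupp.single_eq_of_ne' hkl]
      split_ifs <;> simp [Finsupp.single_eq_of_ne' hkl]
  | zero => simp
  | add x y _ _ hx hy =>
    rw [map_add, map_add, Finsupp.add_apply, hx, hy, map_add, Finsupp.add_apply]
    split_ifs <;> simp
  | smul c x _ hx =>
    rw [map_smul, map_smul, Finsupp.smul_apply, hx, map_smul, Finsupp.smul_apply]
    split_ifs <;> simp

theorem proj_eq_self {P : G → Prop} {x : T} (hx : ∀ k, Y.repr x k ≠ 0 → P k) :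
    proj Y P x = x := by
  apply Y.repr.injective
  ext k
  rw [repr_proj]
  split_ifs with hP
  · rfl
  · by_contra hne
    exact hP (hx k (Ne.symm hne))

open Classical in
theorem proj_mem_span {S : Set G} (x : T) : proj Y (· ∈ S) x ∈ Submodule.span K (Y '' S) := by
  rw [mem_span_image_iff]
  intro k hk
  rw [repr_proj] at hk
  exact (ite_ne_right_iff.mp hk).1

/-- Decreasing measure for the inductions on supports in `proj_coset_mem` and `dvd_of_mul_subset`.
-/
theorem card_support_proj_lt {P : G → Prop} {x : T} {k : G} (hk : Y.repr x k ≠ 0) (hP : ¬ P k) :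
    (Y.repr (proj Y P x)).support.card < (Y.repr x).support.card := by
  classical
  refine Finset.card_lt_card (Finset.ssubset_iff_subset_ne.mpr ⟨fun l hl => ?_, fun heq => ?_⟩)
  · rw [Finsupp.mem_support_iff, repr_proj] at hl
    rw [Finsupp.mem_support_iff]
    exact (ite_ne_right_iff.mp hl).2
  · have := heq ▸ Finsupp.mem_support_iff.mpr hk
    rw [Finsupp.mem_support_iff, repr_proj, if_neg hP] at this
    exact this rfl

variable [AddCommGroup G] {β : G → G → Kˣ} {N : ℕ}

theorem mul_mem_span (h : IsTwistedBasis Y β N) {S₁ S₂ S : Set G}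
    (hS : ∀ k ∈ S₁, ∀ l ∈ S₂, k + l ∈ S) {x y : T}
    (hx : x ∈ Submodule.span K (Y '' S₁)) (hy : y ∈ Submodule.span K (Y '' S₂)) :
    x * y ∈ Submodule.span K (Y '' S) := by
  rw [mem_span_image_iff] at *
  intro m hm
  obtain ⟨k, l, hk, hl, rfl⟩ := h.exists_of_mem_support_mul hm
  exact hS k (hx k hk) l (hy l hl)

/-- The span of the monomials with exponents in a submonoid. -/
def monomials (h : IsTwistedBasis Y β N) (Λ : AddSubmonoid G) : Subalgebra K T :=
  (Submodule.span K (Y '' (Λ : Set G))).toSubalgebra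
    (Submodule.subset_span ⟨0, Λ.zero_mem, h.one_eq⟩)
    (fun _ _ hx hy => h.mul_mem_span (fun _ hk _ hl => Λ.add_mem hk hl) hx hy)

theorem mem_monomials (h : IsTwistedBasis Y β N) {Λ : AddSubmonoid G} {x : T} :
    x ∈ h.monomials Λ ↔ ∀ k, Y.repr x k ≠ 0 → k ∈ Λ :=
  mem_span_image_iff

theorem basis_mem_monomials (h : IsTwistedBasis Y β N) {Λ : AddSubmonoid G} {k : G} (hk : k ∈ Λ) :
    Y k ∈ h.monomials Λ :=
  Submodule.subset_span (s := Y '' (Λ : Set G)) ⟨k, hk, rfl⟩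

/-- For `k ∈ H`, the exponents `k + l` and `l` are in `H` simultaneously, so the projection is
linear over the torus of `H`. -/
theorem proj_mul (h : IsTwistedBasis Y β N) (H : AddSubgroup G) {x : T}
    (hx : x ∈ Submodule.span K (Y '' (H : Set G))) (y : T) :
    proj Y (· ∈ H) (x * y) = x * proj Y (· ∈ H) y := by
  induction hx using Submodule.span_induction with
  | mem x hx =>
    obtain ⟨k, hk, rfl⟩ := hx
    induction Y.mem_span y using Submodule.span_induction with
    | mem y hy =>
      obtain ⟨l, rfl⟩ := hy
      rw [h.mul, Units.smul_def, map_smul, proj_basis, proj_basis, H.add_mem_cancel_left hk]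
      split_ifs
      · rw [h.mul, Units.smul_def]
      · simp
    | zero => simp
    | add x y _ _ hx hy => rw [mul_add, map_add, hx, hy, map_add, mul_add]
    | smul c x _ hx => rw [mul_smul_comm, map_smul, hx, map_smul, mul_smul_comm]
  | zero => simp
  | add x y _ _ hx hy => rw [add_mul, map_add, hx, hy, add_mul]
  | smul c x _ hx => rw [smul_mul_assoc, map_smul, hx, smul_mul_assoc]

/-- A quotient `y = z⁻¹ * x` of elements supported in a subgroup is supported there. -/
theorem mem_of_mul_mem [UniqueSums G] (h : IsTwistedBasis Y β N) (H : AddSubgroup G) {z y : T}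
    (hz0 : z ≠ 0) (hz : z ∈ Submodule.span K (Y '' (H : Set G)))
    (hzy : z * y ∈ Submodule.span K (Y '' (H : Set G))) :
    y ∈ Submodule.span K (Y '' (H : Set G)) := by
  have := h.noZeroDivisors
  have h1 := h.proj_mul H hz y
  rw [proj_eq_self (P := (· ∈ H)) (mem_span_image_iff.mp hzy)] at h1
  rw [mul_left_cancel₀ hz0 h1]
  exact proj_mem_span (S := (H : Set G)) y

theorem repr_basis_mul (h : IsTwistedBasis Y β N) (x : T) (k m : G) :
    Y.repr (Y k * x) (k + m) = β k m * Y.repr x m := by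
  rw [h.repr_mul, Y.repr_self, Finsupp.sum_single_index (by simp), one_mul, add_sub_cancel_left]

theorem repr_mul_basis (h : IsTwistedBasis Y β N) (x : T) (k m : G) :
    Y.repr (x * Y k) (k + m) = β m k * Y.repr x m := by
  rw [h.repr_mul, Finsupp.sum, Finset.sum_eq_single m]
  · rw [add_sub_cancel_right, Y.repr_self, Finsupp.single_eq_same, mul_one, mul_comm]
  · intro l _ hl
    have : k ≠ k + m - l := fun h' => hl (by
      rw [eq_sub_iff_add_eq] at h'
      exact add_left_cancel h')
    rw [Y.repr_self, Finsupp.single_eq_of_ne' this, mul_zero, mul_zero]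
  · intro hm
    rw [Finsupp.notMem_support_iff.mp hm, zero_mul]

/-- The exponents in `L` whose monomials commute with all monomials with exponents in `L`. -/
def radical (h : IsTwistedBasis Y β N) (L : AddSubgroup G) : AddSubgroup G where
  carrier := {k | k ∈ L ∧ ∀ l ∈ L, β k l = β l k}
  zero_mem' := ⟨L.zero_mem, fun l _ => by rw [h.zero_left, h.zero_right]⟩
  add_mem' := fun {a b} ha hb => ⟨L.add_mem ha.1 hb.1, fun l hl => by
    rw [h.add_left, h.add_right, ha.2 l hl, hb.2 l hl]⟩
  neg_mem' := fun {a} ha => ⟨L.neg_mem ha.1, fun l hl => by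
    rw [h.neg_left, h.neg_right, ha.2 l hl]⟩

/-- Comparing the coefficients of `Y l * z` and `z * Y l` at `l + k` forces `β l k = β k l` for each
`k` in the support of `z`. -/
theorem mem_span_radical (h : IsTwistedBasis Y β N) (L : AddSubgroup G) {z : T}
    (hz : z ∈ Submodule.span K (Y '' (L : Set G))) (hc : ∀ l ∈ L, Commute z (Y l)) :
    z ∈ Submodule.span K (Y '' (h.radical L : Set G)) := by
  rw [mem_span_image_iff] at *
  refine fun k hk => ⟨hz k hk, fun l hl => ?_⟩
  have h1 := h.repr_basis_mul z l k
  rw [← (hc l hl).eq, h.repr_mul_basis] at h1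
  exact Units.ext (mul_right_cancel₀ hk h1)

/-- Symmetry of `β` on `H` makes the torus of `H` commutative, and `H` is again free of finite rank;
the commutative case applies. -/
theorem dvd_of_symmetric [UniqueSums G] [Module.Free ℤ G] [Module.Finite ℤ G]
    (h : IsTwistedBasis Y β N) (H : AddSubgroup G) (hH : ∀ k ∈ H, ∀ l ∈ H, β k l = β l k) {z s : T}
    (hz0 : z ≠ 0) (hz : z ∈ Submodule.span K (Y '' (H : Set G)))
    (hs : s ∈ Submodule.span K (Y '' (H : Set G)))
    (hd : ∀ n : ℕ, ∃ t ∈ Submodule.span K (Y '' (H : Set G)), z * s ^ n = z ^ n * t) :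
    ∃ c, s = z * c := by
  have := h.noZeroDivisors
  have : Nontrivial T := ⟨⟨z, 0, hz0⟩⟩
  let S := h.monomials H.toAddSubmonoid
  have hcomm : ∀ a b : S, a * b = b * a := by
    rintro ⟨a, ha⟩ ⟨b, hb⟩
    ext
    change a * b = b * a
    change a ∈ Submodule.span K (Y '' (H : Set G)) at ha
    change b ∈ Submodule.span K (Y '' (H : Set G)) at hb
    induction ha, hb using Submodule.span_induction₂ with
    | mem_mem a b ha hb =>
      obtain ⟨k, hk, rfl⟩ := ha
      obtain ⟨l, hl, rfl⟩ := hb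
      rw [h.mul, h.mul, hH k hk l hl, add_comm]
    | zero_left b hb => simp
    | zero_right a ha => simp
    | add_left a b c _ _ _ h1 h2 => rw [add_mul, mul_add, h1, h2]
    | add_right a b c _ _ _ h1 h2 => rw [add_mul, mul_add, h1, h2]
    | smul_left r a b _ _ h1 => rw [smul_mul_assoc, h1, mul_smul_comm]
    | smul_right r a b _ _ h1 => rw [mul_smul_comm, h1, smul_mul_assoc]
  let _ : CommRing S := { S.toRing with mul_comm := hcomm }
  have : NoZeroDivisors S := Subtype.val_injective.noZeroDivisors _ rfl fun _ _ => rfl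
  have : IsDomain S := NoZeroDivisors.to_isDomain S
  have : Module.Finite ℤ H := inferInstanceAs (Module.Finite ℤ H.toIntSubmodule)
  have : Module.Free ℤ H := inferInstanceAs (Module.Free ℤ H.toIntSubmodule)
  let y : H → S := fun k => ⟨Y k, h.basis_mem_monomials k.2⟩
  have hli : LinearIndependent K y := by
    refine LinearIndependent.of_comp S.val.toLinearMap ?_
    exact Y.linearIndependent.comp _ Subtype.val_injective
  have hsp : Submodule.span K (Set.range y) = ⊤ := by
    rw [eq_top_iff]
    rintro ⟨x, hx⟩ -
    change x ∈ Submodule.span K (Y '' (H : Set G)) at hx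
    have h1 : (Submodule.span K (Set.range y)).map S.val.toLinearMap =
        Submodule.span K (Y '' (H : Set G)) := by
      rw [Submodule.map_span, ← Set.range_comp]
      congr 1
      ext t
      simp [y]
    rw [← h1] at hx
    obtain ⟨t, ht, rfl⟩ := hx
    exact ht
  obtain ⟨_, _⟩ := TwistedMonomial.isNoetherianRing_and_isIntegrallyClosed y hli hsp
    (fun k l => ⟨β k l, Subtype.ext (h.mul k l)⟩)
  have hdvd : (⟨z, hz⟩ : S) ∣ ⟨s, hs⟩ := by
    refine TwistedMonomial.dvd_of_forall_pow_dvd (fun h0 => hz0 (congrArg Subtype.val h0))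
      fun n => ?_
    obtain ⟨t, ht, hzt⟩ := hd n
    exact ⟨⟨t, ht⟩, Subtype.ext hzt⟩
  obtain ⟨c, hc⟩ := hdvd
  exact ⟨c, congrArg Subtype.val hc⟩

end IsTwistedBasis

/-! ### Grading of bimodules by cosets of the radical, and divisibility over the group. -/

namespace IsTwistedBasis

variable {K T G : Type*} [Field K] [Ring T] [Algebra K T] [AddCommGroup G]
  {Y : Module.Basis G K T} {β : G → G → Kˣ} {N : ℕ}

/-- Conjugation by `Y l`. -/
noncomputable def conj (Y : Module.Basis G K T) (β : G → G → Kˣ) (l : G) : T →ₗ[K] T :=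
  LinearMap.mulLeft K (Y l) ∘ₗ LinearMap.mulRight K (β l l • Y (-l))

/-- Since `β l l • Y (-l)` is the inverse of `Y l`, conjugation is diagonal in the monomial basis,
with the commutator of `β` as eigenvalue. -/
theorem conj_basis (h : IsTwistedBasis Y β N) (l k : G) :
    conj Y β l (Y k) = (β l k * (β k l)⁻¹) • Y k := by
  rw [conj, LinearMap.comp_apply, LinearMap.mulLeft_apply, LinearMap.mulRight_apply,
    ← mul_assoc, h.mul_comm_smul, smul_mul_assoc, mul_assoc, mul_smul_comm, h.mul_neg, smul_smul,
    mul_inv_cancel, one_smul, mul_one]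

theorem conj_pow_basis (h : IsTwistedBasis Y β N) (l k : G) (n : ℕ) :
    (conj Y β l ^ n) (Y k) = (β l k * (β k l)⁻¹) ^ n • Y k := by
  induction n with
  | zero => simp
  | succ n ih =>
    rw [pow_succ', Module.End.mul_apply, ih, Units.smul_def, map_smul, h.conj_basis,
      ← Units.smul_def, smul_smul, ← pow_succ]

/-- Averaging the conjugates by powers of `Y l` gives the projections to the eigenspaces. -/
theorem sum_conj (h : IsTwistedBasis Y β N) (l : G) (ζ : Kˣ) (hζ : ζ ^ N = 1) (x : T) :
    ∑ j ∈ Finset.range N, (ζ⁻¹ ^ j : Kˣ) • (conj Y β l ^ j) x =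
      (N : K) • proj Y (fun k => β l k * (β k l)⁻¹ = ζ) x := by
  classical
  induction Y.mem_span x using Submodule.span_induction with
  | mem x hx =>
    obtain ⟨k, rfl⟩ := hx
    simp_rw [h.conj_pow_basis, proj_basis, smul_smul, ← mul_pow]
    simp_rw [Units.smul_def]
    rw [← Finset.sum_smul]
    split_ifs with hk
    · rw [hk, inv_mul_cancel]
      simp
    -- For the other eigenvalues the sum is geometric, with ratio an `N`-th root of unity different
    -- from `1`, hence zero.
    · have h1 : (ζ⁻¹ * (β l k * (β k l)⁻¹)) ^ N = 1 := by
        rw [mul_pow, mul_pow, inv_pow, inv_pow, hζ, h.pow_eq_one, h.pow_eq_one]; simp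
      have h2 : ((ζ⁻¹ * (β l k * (β k l)⁻¹) : Kˣ) : K) ≠ 1 := by
        rw [Ne, Units.val_eq_one, inv_mul_eq_one]
        exact fun h' => hk h'.symm
      have h3 := geom_sum_mul ((ζ⁻¹ * (β l k * (β k l)⁻¹) : Kˣ) : K) N
      rw [← Units.val_pow_eq_pow_val, h1, Units.val_one, sub_self] at h3
      simp_rw [Units.val_pow_eq_pow_val]
      rw [(mul_eq_zero.mp h3).resolve_right (sub_ne_zero.mpr h2), zero_smul, smul_zero]
  | zero => simp
  | add x y _ _ hx hy => simp only [map_add, smul_add, Finset.sum_add_distrib, hx, hy]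
  | smul c x _ hx =>
    rw [map_smul, smul_comm, ← hx, Finset.smul_sum]
    refine Finset.sum_congr rfl fun j _ => ?_
    rw [map_smul, smul_comm]

theorem proj_commutator_mem (h : IsTwistedBasis Y β N) (hN : (N : K) ≠ 0) {L : AddSubgroup G}
    {J : Submodule K T} (hl : ∀ l ∈ L, ∀ x ∈ J, Y l * x ∈ J) (hr : ∀ l ∈ L, ∀ x ∈ J, x * Y l ∈ J)
    {l : G} (hlL : l ∈ L) (ζ : Kˣ) (hζ : ζ ^ N = 1) {x : T} (hx : x ∈ J) :
    proj Y (fun k => β l k * (β k l)⁻¹ = ζ) x ∈ J := by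
  have hconj : ∀ n : ℕ, (conj Y β l ^ n) x ∈ J := by
    intro n
    induction n with
    | zero => exact hx
    | succ n ih =>
      rw [pow_succ', Module.End.mul_apply, conj, LinearMap.comp_apply, LinearMap.mulLeft_apply,
        LinearMap.mulRight_apply, mul_smul_comm, Units.smul_def]
      exact hl _ hlL _ (J.smul_mem _ (hr _ (L.neg_mem hlL) _ ih))
  have h1 := h.sum_conj l ζ hζ x
  have h2 : (N : K) • proj Y (fun k => β l k * (β k l)⁻¹ = ζ) x ∈ J := by
    rw [← h1]
    exact J.sum_mem fun j _ => J.smul_mem _ (hconj j)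
  have h3 := J.smul_mem ((N : K)⁻¹) h2
  rwa [smul_smul, inv_mul_cancel₀ hN, one_smul] at h3

/-- Two exponents in different cosets of the radical are separated by the commutator with some `l ∈
L`. Projecting to the eigenspace of `k₀` under conjugation by `Y l` stays in `J`, keeps the coset of
`k₀` and removes a term outside it; induct on the size of the support. -/
theorem proj_coset_mem (h : IsTwistedBasis Y β N) (hN : (N : K) ≠ 0) {L : AddSubgroup G}
    {J : Submodule K T} (hJL : J ≤ Submodule.span K (Y '' (L : Set G)))
    (hl : ∀ l ∈ L, ∀ x ∈ J, Y l * x ∈ J) (hr : ∀ l ∈ L, ∀ x ∈ J, x * Y l ∈ J)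
    {k₀ : G} (hk₀ : k₀ ∈ L) {x : T} (hx : x ∈ J) :
    proj Y (fun k => k - k₀ ∈ h.radical L) x ∈ J := by
  induction hn : (Y.repr x).support.card using Nat.strong_induction_on generalizing x with
  | _ n ih =>
    by_cases hall : ∀ k, Y.repr x k ≠ 0 → k - k₀ ∈ h.radical L
    · rwa [proj_eq_self hall]
    push Not at hall
    obtain ⟨k, hk, hk'⟩ := hall
    have hkL : k ∈ L := mem_span_image_iff.mp (hJL hx) k hk
    obtain ⟨l, hlL, hne⟩ : ∃ l ∈ L, β (k - k₀) l ≠ β l (k - k₀) := by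
      by_contra! hc
      exact hk' ⟨L.sub_mem hkL hk₀, hc⟩
    let ζ := β l k₀ * (β k₀ l)⁻¹
    have hζ : ζ ^ N = 1 := by rw [mul_pow, inv_pow, h.pow_eq_one, h.pow_eq_one]; simp
    have hcoset : ∀ m, m - k₀ ∈ h.radical L → β l m * (β m l)⁻¹ = ζ := by
      intro m hm
      have h1 := hm.2 l hlL
      obtain ⟨d, rfl⟩ : ∃ d, m = d + k₀ := ⟨m - k₀, (sub_add_cancel _ _).symm⟩
      rw [add_sub_cancel_right] at h1
      rw [h.add_left, h.add_right, h1, mul_inv, mul_mul_mul_comm, mul_inv_cancel, one_mul]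
    have hkζ : ¬ β l k * (β k l)⁻¹ = ζ := by
      intro h1
      obtain ⟨d, rfl⟩ : ∃ d, k = d + k₀ := ⟨k - k₀, (sub_add_cancel _ _).symm⟩
      rw [add_sub_cancel_right] at hne
      rw [h.add_left, h.add_right, mul_inv, mul_mul_mul_comm, mul_eq_right,
        mul_inv_eq_one] at h1
      exact hne h1.symm
    have h2 := ih _ (hn ▸ card_support_proj_lt hk hkζ)
      (h.proj_commutator_mem hN hl hr hlL ζ hζ hx) rfl
    convert h2 using 1
    apply Y.repr.injective
    ext m
    rw [repr_proj, repr_proj, repr_proj]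
    by_cases hm : m - k₀ ∈ h.radical L
    · rw [if_pos hm, if_pos hm, if_pos (hcoset m hm)]
    · rw [if_neg hm, if_neg hm]

/-- If a bimodule `J` over the torus of `L` satisfies `J * J ⊆ z * J` for a nonzero central `z`,
then its elements are multiples of `z`. -/
theorem dvd_of_mul_subset [UniqueSums G] [Module.Free ℤ G] [Module.Finite ℤ G]
    (h : IsTwistedBasis Y β N) (hN : (N : K) ≠ 0) {L : AddSubgroup G}
    {J : Submodule K T} (hJL : J ≤ Submodule.span K (Y '' (L : Set G)))
    (hl : ∀ l ∈ L, ∀ x ∈ J, Y l * x ∈ J) (hr : ∀ l ∈ L, ∀ x ∈ J, x * Y l ∈ J)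
    {z : T} (hz0 : z ≠ 0) (hz : z ∈ Submodule.span K (Y '' (L : Set G)))
    (hc : ∀ l ∈ L, Commute z (Y l)) (hJ : ∀ x ∈ J, ∀ y ∈ J, ∃ w ∈ J, x * y = z * w)
    {x : T} (hx : x ∈ J) : ∃ b, x = z * b := by
  have hzR := h.mem_span_radical L hz hc
  have hzpow : ∀ n : ℕ, z ^ n ∈ Submodule.span K (Y '' (h.radical L : Set G)) := fun n =>
    (h.monomials (h.radical L).toAddSubmonoid).pow_mem hzR n
  have hcoset : ∀ k ∈ L, ∀ x ∈ J, (∀ m, Y.repr x m ≠ 0 → m - k ∈ h.radical L) →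
      ∃ b, x = z * b := by
    intro k hk x hx hxk
    have hs : Y (-k) * x ∈ J := hl _ (L.neg_mem hk) x hx
    have hsR : Y (-k) * x ∈ Submodule.span K (Y '' (h.radical L : Set G)) := by
      rw [mem_span_image_iff]
      intro m hm
      obtain ⟨i, j, hi, hj, rfl⟩ := h.exists_of_mem_support_mul hm
      have : -k = i := by
        by_contra hne
        rw [Y.repr_self, Finsupp.single_eq_of_ne' hne] at hi
        exact hi rfl
      rw [← this, neg_add_eq_sub]
      exact hxk j hj
    -- Iterating `J * J ⊆ z * J` on `s = Y (-k) * x`, which lies in the torus of the radical.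
    have hpow : ∀ n : ℕ, ∃ w ∈ J, (Y (-k) * x) ^ (n + 1) = z ^ n * w := by
      intro n
      induction n with
      | zero => exact ⟨_, hs, by rw [zero_add, pow_one, pow_zero, one_mul]⟩
      | succ n ih =>
        obtain ⟨w, hw, hw'⟩ := ih
        obtain ⟨v, hv, hv'⟩ := hJ w hw _ hs
        exact ⟨v, hv, by rw [pow_succ, hw', mul_assoc, hv', pow_succ, mul_assoc]⟩
    obtain ⟨c, hc⟩ := h.dvd_of_symmetric (h.radical L)
      (fun k hk l hl => hk.2 l hl.1) hz0 hzR hsR (fun n => by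
        cases n with
        | zero => exact ⟨z, hzR, by rw [pow_zero, pow_zero, mul_one, one_mul]⟩
        | succ n =>
          obtain ⟨w, hw, hw'⟩ := hpow n
          -- `w` is only known to lie in `J`, but `z ^ n * w` is supported in the radical, so `w`
          -- may be replaced by its projection.
          refine ⟨proj Y (· ∈ h.radical L) w, proj_mem_span (S := (h.radical L : Set G)) w, ?_⟩
          rw [← h.proj_mul _ (hzpow _), pow_succ' z, mul_assoc, ← hw']
          refine (proj_eq_self (P := (· ∈ h.radical L)) (mem_span_image_iff.mp ?_)).symm
          exact (h.monomials (h.radical L).toAddSubmonoid).mul_mem hzR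
            ((h.monomials (h.radical L).toAddSubmonoid).pow_mem hsR _))
    -- `β k k • Y k` is the inverse of `Y (-k)`, which undoes the translation.
    refine ⟨β k k • (Y k * c), ?_⟩
    rw [mul_smul_comm, ← mul_assoc, (‹∀ l ∈ L, Commute z (Y l)› k hk).eq, mul_assoc, ← hc,
      ← mul_assoc, h.mul_neg, smul_mul_assoc, one_mul, smul_smul, mul_inv_cancel, one_smul]
  induction hn : (Y.repr x).support.card using Nat.strong_induction_on generalizing x with
  | _ n ih =>
    by_cases hx0 : x = 0
    · exact ⟨0, by rw [hx0, mul_zero]⟩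
    obtain ⟨k, hk, -⟩ := exists_minimum (Y := Y) 0 hx0
    have hkL : k ∈ L := mem_span_image_iff.mp (hJL hx) k hk
    let P : G → Prop := fun m => m - k ∈ h.radical L
    have h1 : proj Y P x ∈ J := h.proj_coset_mem hN hJL hl hr hkL hx
    have h2 : x - proj Y P x = proj Y (fun m => ¬ P m) x := by
      apply Y.repr.injective
      ext m
      rw [map_sub, Finsupp.sub_apply, repr_proj, repr_proj]
      split_ifs <;> simp
    have hPk : P k := by
      simp only [P, sub_self]
      exact zero_mem _
    obtain ⟨b, hb⟩ := hcoset k hkL _ h1 fun m hm => by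
      rw [repr_proj] at hm
      by_contra hP
      exact hm (if_neg hP)
    obtain ⟨b', hb'⟩ := ih _ (hn ▸ card_support_proj_lt (P := fun m => ¬ P m) hk (not_not.mpr hPk))
      (h2 ▸ J.sub_mem hx h1) rfl
    refine ⟨b + b', ?_⟩
    rw [mul_add, ← hb, ← hb', ← h2, add_sub_cancel]

end IsTwistedBasis

/-! ### From the group back to the monoid; finite generation of exponents modulo `N`. -/

namespace IsTwistedBasis

variable {K T G : Type*} [Field K] [Ring T] [Algebra K T] [AddCommGroup G]
  {Y : Module.Basis G K T} {β : G → G → Kˣ} {N : ℕ}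

theorem add_eq (h : IsTwistedBasis Y β N) (k l : G) : Y (k + l) = (β k l)⁻¹ • (Y k * Y l) := by
  rw [h.mul, smul_smul, inv_mul_cancel, one_smul]

theorem neg_nsmul_mul (h : IsTwistedBasis Y β N) (m : G) (x : T) :
    Y (N • m) * (Y (N • -m) * x) = x := by
  rw [← mul_assoc, h.mul_nsmul, ← nsmul_add, add_neg_cancel, smul_zero, h.one_eq, one_mul]

theorem commute_closure (h : IsTwistedBasis Y β N) {S : Set G} {z : T}
    (hz : ∀ l ∈ S, Commute z (Y l)) {l : G} (hl : l ∈ AddSubgroup.closure S) :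
    Commute z (Y l) := by
  induction hl using AddSubgroup.closure_induction with
  | mem l hl => exact hz l hl
  | zero => rw [h.one_eq]; exact Commute.one_right z
  | add k l _ _ hk hl =>
    rw [h.add_eq]
    exact (hk.mul_right hl).smul_right _
  | neg l _ hl =>
    let u : Tˣ := ⟨Y l, β l l • Y (-l),
      by rw [mul_smul_comm, h.mul_neg, smul_smul, mul_inv_cancel, one_smul],
      by rw [smul_mul_assoc, h.neg_mul, smul_smul, mul_inv_cancel, one_smul]⟩
    have h1 : Commute z ((u⁻¹ : Tˣ) : T) := Commute.units_inv_right (u := u) hl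
    have h2 : Y (-l) = (β l l)⁻¹ • ((u⁻¹ : Tˣ) : T) := by
      change _ = (β l l)⁻¹ • β l l • Y (-l)
      rw [smul_smul, inv_mul_cancel, one_smul]
    rw [h2]
    exact h1.smul_right _

/-- The elements of the torus with a multiple by some `Y (N • m)`, `m ∈ Λ`, in `I`. -/
def saturation (h : IsTwistedBasis Y β N) (Λ : AddSubmonoid G) (I : Submodule K T)
    (hI : ∀ l ∈ Λ, ∀ x ∈ I, Y l * x ∈ I) : Submodule K T where
  carrier := {x | ∃ m ∈ Λ, Y (N • m) * x ∈ I}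
  zero_mem' := ⟨0, Λ.zero_mem, by rw [mul_zero]; exact I.zero_mem⟩
  add_mem' := by
    rintro x y ⟨m, hm, hx⟩ ⟨n, hn, hy⟩
    refine ⟨m + n, Λ.add_mem hm hn, ?_⟩
    rw [mul_add, nsmul_add]
    refine I.add_mem ?_ ?_
    · rw [add_comm, ← h.mul_nsmul, mul_assoc]
      exact hI _ (Λ.nsmul_mem hn N) _ hx
    · rw [← h.mul_nsmul, mul_assoc]
      exact hI _ (Λ.nsmul_mem hm N) _ hy
  smul_mem' := by
    rintro c x ⟨m, hm, hx⟩
    exact ⟨m, hm, by rw [mul_smul_comm]; exact I.smul_mem c hx⟩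

theorem nsmul_mul_comm (h : IsTwistedBasis Y β N) (m : G) (x y : T) :
    Y (N • m) * (x * y) = x * (Y (N • m) * y) := by
  rw [← mul_assoc, (h.commute_nsmul m x).eq, mul_assoc]

/-- For `l ∈ Λ`, multiplying `Y (-l)` by the allowed denominator `Y (N • l)` gives `Y ((N - 1) •
l)`, which preserves `I`. Treating `l` and `-l` together makes the negation step of the closure
induction a swap. -/
theorem saturation_mul_mem (h : IsTwistedBasis Y β N) (hN : N ≠ 0) {Λ : AddSubmonoid G}
    {I : Submodule K T} (hl : ∀ l ∈ Λ, ∀ x ∈ I, Y l * x ∈ I) (hr : ∀ l ∈ Λ, ∀ x ∈ I, x * Y l ∈ I)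
    {l : G} (hlL : l ∈ AddSubgroup.closure (Λ : Set G)) :
    ∀ x ∈ h.saturation Λ I hl, (Y l * x ∈ h.saturation Λ I hl ∧ x * Y l ∈ h.saturation Λ I hl) ∧
      (Y (-l) * x ∈ h.saturation Λ I hl ∧ x * Y (-l) ∈ h.saturation Λ I hl) := by
  induction hlL using AddSubgroup.closure_induction with
  | mem l hlΛ =>
    rintro x ⟨m, hm, hx⟩
    have hpred : (N - 1) • l ∈ Λ := Λ.nsmul_mem hlΛ _
    have hsub : N • l + -l = (N - 1) • l := by
      obtain ⟨n, rfl⟩ := Nat.exists_eq_succ_of_ne_zero hN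
      rw [Nat.succ_eq_add_one, add_nsmul, one_smul, add_neg_cancel_right, Nat.add_sub_cancel]
    have hsum : Y (N • (l + m)) = Y (N • l) * Y (N • m) := by rw [h.mul_nsmul, nsmul_add]
    refine ⟨⟨⟨m, hm, ?_⟩, ⟨m, hm, ?_⟩⟩,
      ⟨l + m, Λ.add_mem hlΛ hm, ?_⟩, ⟨l + m, Λ.add_mem hlΛ hm, ?_⟩⟩
    · rw [h.nsmul_mul_comm]; exact hl l hlΛ _ hx
    · rw [← mul_assoc]; exact hr l hlΛ _ hx
    · rw [hsum, mul_assoc, h.nsmul_mul_comm m, ← mul_assoc, h.nsmul_mul, hsub]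
      exact hl _ hpred _ hx
    · rw [hsum, mul_assoc, ← mul_assoc (Y (N • m)), h.nsmul_mul_comm, h.nsmul_mul, hsub]
      exact hr _ hpred _ hx
  | zero =>
    intro x hx
    rw [neg_zero, h.one_eq, one_mul, mul_one]
    exact ⟨⟨hx, hx⟩, hx, hx⟩
  | add k l _ _ hk hl' =>
    intro x hx
    rw [neg_add, h.add_eq, h.add_eq]
    simp only [smul_mul_assoc, mul_smul_comm, mul_assoc, Units.smul_def]
    simp only [← mul_assoc x]
    exact ⟨⟨Submodule.smul_mem _ _ (hk _ (hl' x hx).1.1).1.1,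
      Submodule.smul_mem _ _ (hl' _ (hk x hx).1.2).1.2⟩,
      Submodule.smul_mem _ _ (hk _ (hl' x hx).2.1).2.1,
      Submodule.smul_mem _ _ (hl' _ (hk x hx).2.2).2.2⟩
  | neg l _ ih =>
    intro x hx
    rw [neg_neg]
    exact (ih x hx).symm

/-- If `Λ` is cut out of the group it generates by half-spaces, a bimodule `I` over the monomial
algebra of `Λ` with `I * I ⊆ z * I`, where `z ≠ 0` is central, is contained in the multiples
of `z` in this algebra. -/
theorem exists_eq_mul_of_mul_subset [UniqueSums G] [Module.Free ℤ G] [Module.Finite ℤ G]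
    (h : IsTwistedBasis Y β N) (hN : (N : K) ≠ 0) {Λ : AddSubmonoid G}
    (hΛ : ∀ k ∈ AddSubgroup.closure (Λ : Set G),
      (∀ f : G →+ ℝ, (∀ l ∈ Λ, 0 ≤ f l) → 0 ≤ f k) → k ∈ Λ)
    {I : Submodule K T} (hIΛ : ∀ x ∈ I, x ∈ h.monomials Λ)
    (hl : ∀ l ∈ Λ, ∀ x ∈ I, Y l * x ∈ I) (hr : ∀ l ∈ Λ, ∀ x ∈ I, x * Y l ∈ I)
    {z : T} (hz0 : z ≠ 0) (hz : z ∈ h.monomials Λ) (hc : ∀ l ∈ Λ, Commute z (Y l))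
    (hI : ∀ x ∈ I, ∀ y ∈ I, ∃ w ∈ I, x * y = z * w) {x : T} (hx : x ∈ I) :
    ∃ b ∈ h.monomials Λ, x = z * b := by
  have := h.noZeroDivisors
  have : Nontrivial T := ⟨⟨z, 0, hz0⟩⟩
  have hN0 : N ≠ 0 := by
    rintro rfl
    simp at hN
  let L := AddSubgroup.closure (Λ : Set G)
  have hΛL : (Λ : Set G) ⊆ L := AddSubgroup.subset_closure
  have hspan : ∀ x, x ∈ h.monomials Λ → x ∈ Submodule.span K (Y '' (L : Set G)) :=
    fun x hx => Submodule.span_mono (Set.image_mono hΛL) hx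
  have hcL : ∀ l ∈ L, Commute z (Y l) := fun l hl => h.commute_closure hc hl
  let J := h.saturation Λ I hl
  have hIJ : ∀ x ∈ I, x ∈ J := fun x hx =>
    ⟨0, Λ.zero_mem, by rw [smul_zero, h.one_eq, one_mul]; exact hx⟩
  have hJL : J ≤ Submodule.span K (Y '' (L : Set G)) := by
    rintro x ⟨m, hm, hx⟩
    exact h.mem_of_mul_mem L (Y.ne_zero _)
      (Submodule.subset_span ⟨_, L.nsmul_mem (hΛL hm) N, rfl⟩) (hspan _ (hIΛ _ hx))
  have hJJ : ∀ x ∈ J, ∀ y ∈ J, ∃ w ∈ J, x * y = z * w := by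
    rintro x ⟨m, hm, hx⟩ y ⟨n, hn, hy⟩
    obtain ⟨w, hw, hxy⟩ := hI _ hx _ hy
    -- The denominators of `x` and `y` are central, so both move to the other side.
    refine ⟨Y (N • -m) * (Y (N • -n) * w), ⟨n + m, Λ.add_mem hn hm, ?_⟩, ?_⟩
    · rw [nsmul_add, ← h.mul_nsmul, mul_assoc, h.neg_nsmul_mul, h.neg_nsmul_mul]
      exact hw
    · have h1 : ∀ m t, Y (N • -m) * (Y (N • m) * t) = t := fun m t => by
        simpa using h.neg_nsmul_mul (-m) t
      rw [← h.nsmul_mul_comm, ← h.nsmul_mul_comm, ← hxy, mul_assoc, ← h.nsmul_mul_comm n,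
        h.nsmul_mul_comm (-n), h1, h1]
  obtain ⟨b, rfl⟩ := h.dvd_of_mul_subset hN hJL
    (fun l hlL x hx => (h.saturation_mul_mem hN0 hl hr hlL x hx).1.1)
    (fun l hlL x hx => (h.saturation_mul_mem hN0 hl hr hlL x hx).1.2)
    hz0 (hspan z hz) hcL hJJ (hIJ x hx)
  have hbL := h.mem_of_mul_mem L hz0 (hspan z hz) (hspan _ (hIΛ _ hx))
  have hzb : Commute z b := by
    clear hx
    induction hbL using Submodule.span_induction with
    | mem b hb => obtain ⟨l, hl, rfl⟩ := hb; exact hcL l hl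
    | zero => exact Commute.zero_right z
    | add a b _ _ ha hb => exact ha.add_right hb
    | smul c b _ hb => exact hb.smul_right c
  refine ⟨b, ?_, rfl⟩
  -- `(z * b ^ (n + 1)) * (z * b) = z * w` with `w ∈ I`; cancelling `z` gives `w = z * b ^ (n + 2)`.
  have hpow : ∀ n : ℕ, z * b ^ (n + 1) ∈ I := by
    intro n
    induction n with
    | zero => rwa [zero_add, pow_one]
    | succ n ih =>
      obtain ⟨w, hw, hw'⟩ := hI _ ih _ hx
      rw [← mul_assoc, mul_assoc z, ← (hzb.pow_right (n + 1)).eq, mul_assoc, mul_assoc] at hw'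
      have h1 := mul_left_cancel₀ hz0 hw'
      rw [← pow_succ] at h1
      rwa [h1]
  rw [h.mem_monomials]
  intro k hk
  refine hΛ k (mem_span_image_iff.mp hbL k hk) fun f hf =>
    h.nonneg_of_forall_mul_pow f hz0 (fun n l hn => hf l ?_) hk
  cases n with
  | zero => rw [pow_zero, mul_one] at hn; exact h.mem_monomials.mp hz l hn
  | succ n => exact h.mem_monomials.mp (hIΛ _ (hpow n)) l hn

/-- For finitely generated `Λ`, the monomial algebra is spanned by finitely many monomials over
those with exponents in `N • Λ`. -/
theorem exists_finset_span (h : IsTwistedBasis Y β N) (hN : N ≠ 0) {Λ : AddSubmonoid G}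
    (hfg : Λ.FG) : ∃ F : Finset G, (∀ k ∈ F, k ∈ Λ) ∧
      ∀ k ∈ Λ, ∃ m ∈ Λ, ∃ l ∈ F, Y k = Y (N • m) * Y l := by
  classical
  obtain ⟨S, rfl⟩ := hfg
  suffices ∃ F : Finset G, (∀ k ∈ F, k ∈ AddSubmonoid.closure (S : Set G)) ∧
      ∀ k ∈ AddSubmonoid.closure (S : Set G), ∃ m ∈ AddSubmonoid.closure (S : Set G),
        ∃ l ∈ F, k = N • m + l by
    obtain ⟨F, hF, hF'⟩ := this
    refine ⟨F, hF, fun k hk => ?_⟩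
    obtain ⟨m, hm, l, hl, rfl⟩ := hF' k hk
    exact ⟨m, hm, l, hl, (h.nsmul_mul m l).symm⟩
  clear h
  induction S using Finset.induction_on with
  | empty =>
    refine ⟨{0}, by simp, fun k hk => ⟨0, zero_mem _, 0, by simp, ?_⟩⟩
    simpa using hk
  | insert a S _ ih =>
    obtain ⟨F, hF, hF'⟩ := ih
    have hle : AddSubmonoid.closure (S : Set G) ≤
        AddSubmonoid.closure ((insert a S : Finset G) : Set G) :=
      AddSubmonoid.closure_mono (by simp)
    have ha : a ∈ AddSubmonoid.closure ((insert a S : Finset G) : Set G) :=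
      AddSubmonoid.subset_closure (by simp)
    -- The multiplicity of the new generator `a` is divided by `N`; only its remainder enters the
    -- finite set.
    refine ⟨(Finset.range N ×ˢ F).image fun t => t.1 • a + t.2, ?_, ?_⟩
    · intro k hk
      obtain ⟨⟨j, l⟩, hjl, rfl⟩ := Finset.mem_image.mp hk
      exact add_mem (nsmul_mem ha _) (hle (hF l (Finset.mem_product.mp hjl).2))
    · intro k hk
      rw [Finset.coe_insert, Set.insert_eq, AddSubmonoid.closure_union, AddSubmonoid.mem_sup] at hk
      obtain ⟨x, hx, y, hy, rfl⟩ := hk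
      obtain ⟨n, rfl⟩ := AddSubmonoid.mem_closure_singleton.mp hx
      obtain ⟨m, hm, l, hl, rfl⟩ := hF' y hy
      refine ⟨(n / N) • a + m, add_mem (nsmul_mem ha _) (hle hm), (n % N) • a + l,
        Finset.mem_image.mpr ⟨(n % N, l), Finset.mem_product.mpr
          ⟨Finset.mem_range.mpr (Nat.mod_lt _ (Nat.pos_of_ne_zero hN)), hl⟩, rfl⟩, ?_⟩
      conv_lhs => rw [← Nat.div_add_mod n N]
      rw [add_nsmul, mul_nsmul', nsmul_add]
      abel

end IsTwistedBasis

/-! ### The ordered monomials form a twisted basis of the quantum torus. -/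

namespace QuantumTorus

variable {K : Type*} [Field K] {p : ℕ} {U : Matrix (Fin p) (Fin p) ℤ} {q : Kˣ}

theorem zpow_mul_zpow_of_mul_eq {H : Type*} [Group H] {x y c : H} (hc : ∀ g, Commute c g)
    (h : x * y = c * (y * x)) (a b : ℤ) : x ^ a * y ^ b = c ^ (a * b) * (y ^ b * x ^ a) := by
  have key : ∀ {x y c : H}, (∀ g, Commute c g) → x * y = c * (y * x) → ∀ b : ℤ,
      x * y ^ b = c ^ b * (y ^ b * x) := by
    intro x y c hc h b
    have h1 : x * y * x⁻¹ = c * y := by rw [h, ← mul_assoc, mul_inv_cancel_right]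
    have h2 := conj_zpow (i := b) (a := x) (b := y)
    rw [h1, (hc y).mul_zpow] at h2
    rw [← mul_assoc, h2, inv_mul_cancel_right]
  have h1 := key hc h b
  have h2 : y ^ b * x = (c ^ b)⁻¹ * (x * y ^ b) := by rw [h1, inv_mul_cancel_left]
  have h3 := key (fun g => ((hc g).zpow_left b).inv_left) h2 a
  rw [h3, ← mul_assoc, inv_zpow, mul_comm a, zpow_mul, mul_inv_cancel, one_mul]

theorem scalar_commute (c : Kˣ) (g : (QuantumTorus U q)ˣ) : Commute (scalar U q c) g :=
  Units.ext (Algebra.commutes (c : K) (g : QuantumTorus U q))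

theorem scalar_mul (c e : Kˣ) : scalar U q (c * e) = scalar U q c * scalar U q e :=
  map_mul _ _ _

theorem scalar_zpow (c : Kˣ) (n : ℤ) : scalar U q (c ^ n) = scalar U q c ^ n :=
  map_zpow (Units.map (algebraMap K (QuantumTorus U q)).toMonoidHom) c n

theorem val_scalar_mul (c : Kˣ) (t : (QuantumTorus U q)ˣ) :
    ((scalar U q c * t : (QuantumTorus U q)ˣ) : QuantumTorus U q) =
      c • (t : QuantumTorus U q) := by
  rw [Units.val_mul, Units.smul_def, Algebra.smul_def]
  rfl

theorem x_mul_x (i j : Fin p) :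
    x U q i * x U q j = scalar U q (q ^ U i j) * (x U q j * x U q i) := by
  ext
  rw [val_scalar_mul, Units.smul_def]
  have := mk_rel U q (Rel.comm i j)
  rw [map_mul, map_smul, map_mul] at this
  exact this

theorem x_zpow_mul_x_zpow (i j : Fin p) (a b : ℤ) :
    x U q i ^ a * x U q j ^ b =
      scalar U q (q ^ (U i j * (a * b))) * (x U q j ^ b * x U q i ^ a) := by
  rw [zpow_mul q, scalar_zpow, zpow_mul_zpow_of_mul_eq (scalar_commute _) (x_mul_x i j)]

variable (U q) in
/-- The ordered monomial of exponent `k` in the variables of the list `l`. -/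
def listMonomial (l : List (Fin p)) (k : Fin p → ℤ) : (QuantumTorus U q)ˣ :=
  (l.map fun i => x U q i ^ k i).prod

theorem listMonomial_cons (i : Fin p) (l : List (Fin p)) (k : Fin p → ℤ) :
    listMonomial U q (i :: l) k = x U q i ^ k i * listMonomial U q l k := by
  rw [listMonomial, List.map_cons, List.prod_cons, listMonomial]

theorem exists_listMonomial_mul_x (l : List (Fin p)) (i : Fin p) :
    ∃ f : (Fin p → ℤ) →+ ℤ, ∀ k a, listMonomial U q l k * x U q i ^ a =
      scalar U q (q ^ (f k * a)) * (x U q i ^ a * listMonomial U q l k) := by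
  induction l with
  | nil =>
    refine ⟨0, fun k a => ?_⟩
    simp [listMonomial, scalar]
  | cons j l ih =>
    obtain ⟨f, hf⟩ := ih
    let g : (Fin p → ℤ) →+ ℤ :=
      f + (AddMonoidHom.mulLeft (U j i)).comp (Pi.evalAddMonoidHom (fun _ => ℤ) j)
    refine ⟨g, fun k a => ?_⟩
    have h1 : g k * a = f k * a + U j i * (k j * a) := by
      simp only [g, AddMonoidHom.add_apply, AddMonoidHom.comp_apply, Pi.evalAddMonoidHom_apply,
        AddMonoidHom.coe_mulLeft]
      ring
    rw [listMonomial_cons, h1, zpow_add, scalar_mul, mul_assoc, hf, ← mul_assoc,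
      ((scalar_commute _ _).symm).eq, mul_assoc, ← mul_assoc (x U q j ^ k j), x_zpow_mul_x_zpow]
    simp only [mul_assoc]

/-- Moving `x i ^ n i` past the tail of the first monomial costs a power of `q` whose exponent is
additive in `k` and in `n`. Biadditivity of `B` is all that is needed for `β = q ^ B` to be a
bicharacter. -/
theorem exists_listMonomial_mul (l : List (Fin p)) :
    ∃ B : (Fin p → ℤ) →+ (Fin p → ℤ) →+ ℤ, ∀ k n, listMonomial U q l k * listMonomial U q l n =
      scalar U q (q ^ B k n) * listMonomial U q l (k + n) := by
  induction l with
  | nil =>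
    refine ⟨0, fun k n => ?_⟩
    simp [listMonomial, scalar]
  | cons i l ih =>
    obtain ⟨B, hB⟩ := ih
    obtain ⟨f, hf⟩ := exists_listMonomial_mul_x (U := U) (q := q) l i
    let C : (Fin p → ℤ) →+ (Fin p → ℤ) →+ ℤ :=
      AddMonoidHom.mk' (fun k => (AddMonoidHom.mulLeft (f k)).comp (Pi.evalAddMonoidHom _ i))
        (fun k k' => by ext; simp [add_mul])
    refine ⟨C + B, fun k n => ?_⟩
    have h1 : (C + B) k n = f k * n i + B k n := rfl
    rw [h1, zpow_add, scalar_mul]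
    simp only [listMonomial_cons]
    calc _ = x U q i ^ k i * (listMonomial U q l k * x U q i ^ n i) * listMonomial U q l n := by
          group
      _ = x U q i ^ k i * scalar U q (q ^ (f k * n i)) * x U q i ^ n i *
          (listMonomial U q l k * listMonomial U q l n) := by
          rw [hf]; group
      _ = scalar U q (q ^ (f k * n i)) * x U q i ^ k i * x U q i ^ n i * (scalar U q (q ^ B k n) *
          listMonomial U q l (k + n)) := by
          rw [hB, (scalar_commute _ (x U q i ^ k i)).eq]
      _ = scalar U q (q ^ (f k * n i)) * x U q i ^ k i * (x U q i ^ n i * scalar U q (q ^ B k n)) *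
          listMonomial U q l (k + n) := by
          group
      _ = scalar U q (q ^ (f k * n i)) * (x U q i ^ k i * scalar U q (q ^ B k n)) * x U q i ^ n i *
          listMonomial U q l (k + n) := by
          rw [← (scalar_commute _ (x U q i ^ n i)).eq]; group
      _ = _ := by
          rw [← (scalar_commute _ (x U q i ^ k i)).eq, Pi.add_apply, zpow_add]; group

theorem listMonomial_single (l : List (Fin p)) (hl : l.Nodup) (i : Fin p) (a : ℤ) :
    listMonomial U q l (Pi.single i a) = if i ∈ l then x U q i ^ a else 1 := by
  induction l with
  | nil => simp [listMonomial]
  | cons j l ih =>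
    rw [List.nodup_cons] at hl
    rw [listMonomial_cons, ih hl.2]
    by_cases hij : i = j
    · subst hij
      simp [hl.1]
    · simp [hij]

variable (U q) in
/-- The ordered monomial `x_1 ^ k_1 ⋯ x_p ^ k_p`. -/
def monomial (k : Fin p → ℤ) : QuantumTorus U q :=
  (listMonomial U q (List.finRange p) k : (QuantumTorus U q)ˣ)

/-- The Weyl normalization is only a unit scalar, so spans of monomials do not see the choice of
square root. -/
theorem X_eq_smul_monomial (qHalf : Kˣ) (k : Fin p → ℤ) :
    ∃ c : Kˣ, X U q qHalf k = c • monomial U q k :=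
  ⟨_, rfl⟩

theorem exists_monomial_mul :
    ∃ B : (Fin p → ℤ) →+ (Fin p → ℤ) →+ ℤ, ∀ k n, monomial U q k * monomial U q n =
      q ^ B k n • monomial U q (k + n) := by
  obtain ⟨B, hB⟩ := exists_listMonomial_mul (U := U) (q := q) (List.finRange p)
  refine ⟨B, fun k n => ?_⟩
  rw [monomial, monomial, ← Units.val_mul, hB, val_scalar_mul, monomial]

theorem mk_surjective : Function.Surjective (mk U q) :=
  RingQuot.mkAlgHom_surjective K _

theorem span_monomial : Submodule.span K (Set.range (monomial U q)) = ⊤ := by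
  obtain ⟨B, hB⟩ := exists_monomial_mul (U := U) (q := q)
  have hsingle : ∀ (i : Fin p) (a : ℤ), monomial U q (Pi.single i a) =
      ((x U q i ^ a : (QuantumTorus U q)ˣ) : QuantumTorus U q) := fun i a => by
    rw [monomial, listMonomial_single _ (List.nodup_finRange p), if_pos (List.mem_finRange i)]
  let S : Subalgebra K (QuantumTorus U q) :=
    (Submodule.span K (Set.range (monomial U q))).toSubalgebra
      (Submodule.subset_span ⟨0, by simp [monomial, listMonomial]⟩)
      (by
        intro a b ha hb
        have h := Submodule.mul_mem_mul ha hb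
        rw [Submodule.span_mul_span] at h
        refine Submodule.span_le.mpr ?_ h
        rintro _ ⟨_, ⟨k, rfl⟩, _, ⟨n, rfl⟩, rfl⟩
        change monomial U q k * monomial U q n ∈ _
        rw [hB, Units.smul_def]
        exact Submodule.smul_mem _ _ (Submodule.subset_span ⟨k + n, rfl⟩))
  rw [eq_top_iff]
  rintro t -
  obtain ⟨t, rfl⟩ := mk_surjective t
  change mk U q t ∈ S
  induction t using FreeAlgebra.induction with
  | grade0 r => rw [AlgHom.commutes]; exact S.algebraMap_mem r
  | grade1 t =>
    obtain ⟨i, _ | _⟩ := t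
    · refine Submodule.subset_span ⟨Pi.single i (-1), ?_⟩
      rw [hsingle, zpow_neg_one]
      rfl
    · refine Submodule.subset_span ⟨Pi.single i 1, ?_⟩
      rw [hsingle, zpow_one]
      rfl
  | mul a b ha hb => rw [map_mul]; exact S.mul_mem ha hb
  | add a b ha hb => rw [map_add]; exact S.add_mem ha hb

/-- The operator `e_k ↦ w k • e_{k + d}` on functions on the exponents. -/
noncomputable def weightedShift {G : Type*} [AddCommGroup G] (d : G) (w : G → Kˣ) :
    Module.End K (G →₀ K) :=
  Finsupp.linearCombination K fun k => Finsupp.single (k + d) (w k : K)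

theorem weightedShift_single {G : Type*} [AddCommGroup G] (d : G) (w : G → Kˣ) (k : G) (c : K) :
    weightedShift d w (Finsupp.single k c) = Finsupp.single (k + d) (c * w k) := by
  rw [weightedShift, Finsupp.linearCombination_single, Finsupp.smul_single, smul_eq_mul]

variable (U q) in
/-- The weight of `x i` on the ordered monomial of exponent `k`. -/
def weight (i : Fin p) (k : Fin p → ℤ) : Kˣ :=
  q ^ ∑ j ∈ Finset.Iio i, U i j * k j

theorem weight_add_single (i j : Fin p) (k : Fin p → ℤ) :
    weight U q i (k + Pi.single j 1) = weight U q i k * q ^ (if j < i then U i j else 0) := by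
  rw [weight, weight, ← zpow_add]
  congr 1
  simp only [Pi.add_apply, mul_add, Finset.sum_add_distrib, Pi.single_apply, mul_ite, mul_one,
    mul_zero, Finset.sum_ite_eq', Finset.mem_Iio]

variable (U q) in
/-- The images of the generators under the action on functions on the exponents. -/
noncomputable def generatorAction : Fin p × Bool → Module.End K ((Fin p → ℤ) →₀ K)
  | (i, true) => weightedShift (Pi.single i 1) (weight U q i)
  | (i, false) => weightedShift (-Pi.single i 1) fun k => (weight U q i (k - Pi.single i 1))⁻¹

/-- The weights imitate left multiplication on ordered monomials, where `x i` must pass each `x j`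
with `j < i`. For `i ≠ j` exactly one order of the two shifts picks up a factor, and antisymmetry of
`U` makes it the required one. -/
theorem generatorAction_rel (hU : U.transpose = -U) ⦃a b : FreeAlgebra K (Fin p × Bool)⦄
    (h : Rel U q a b) : FreeAlgebra.lift K (generatorAction U q) a =
      FreeAlgebra.lift K (generatorAction U q) b := by
  induction h with
  | mul_inv i =>
    rw [map_mul, FreeAlgebra.lift_ι_apply, FreeAlgebra.lift_ι_apply, map_one]
    refine Finsupp.lhom_ext fun k c => ?_
    simp only [generatorAction, Module.End.mul_apply, weightedShift_single, Module.End.one_apply]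
    rw [neg_add_cancel_right, ← sub_eq_add_neg, mul_assoc, Units.inv_mul, mul_one]
  | inv_mul i =>
    rw [map_mul, FreeAlgebra.lift_ι_apply, FreeAlgebra.lift_ι_apply, map_one]
    refine Finsupp.lhom_ext fun k c => ?_
    simp only [generatorAction, Module.End.mul_apply, weightedShift_single, Module.End.one_apply]
    rw [add_neg_cancel_right, add_sub_cancel_right, mul_assoc, Units.mul_inv, mul_one]
  | comm i j =>
    rw [map_smul, map_mul, map_mul, FreeAlgebra.lift_ι_apply, FreeAlgebra.lift_ι_apply]
    refine Finsupp.lhom_ext fun k c => ?_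
    simp only [generatorAction, LinearMap.smul_apply, Module.End.mul_apply, weightedShift_single]
    rw [weight_add_single, weight_add_single, Finsupp.smul_single, smul_eq_mul, add_right_comm]
    congr 1
    have hij : U j i = -U i j := by
      have := congrFun (congrFun hU i) j
      rwa [Matrix.transpose_apply, Matrix.neg_apply] at this
    have h1 : q ^ (if j < i then U i j else 0) =
        q ^ U i j * q ^ (if i < j then U j i else 0) := by
      rw [← zpow_add]
      congr 1
      rcases lt_trichotomy i j with h | h | h
      · rw [if_neg h.not_gt, if_pos h, hij, add_neg_cancel]
      · subst h
        simp only [lt_irrefl, if_false]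
        omega
      · rw [if_pos h, if_neg h.not_gt, add_zero]
    rw [h1]
    push_cast
    ring

/-- The action of the quantum torus on functions on the exponents. -/
noncomputable def action (hU : U.transpose = -U) :
    QuantumTorus U q →ₐ[K] Module.End K ((Fin p → ℤ) →₀ K) :=
  RingQuot.liftAlgHom K ⟨FreeAlgebra.lift K (generatorAction U q), generatorAction_rel hU⟩

theorem action_x (hU : U.transpose = -U) (i : Fin p) :
    action (q := q) hU (x U q i) = weightedShift (Pi.single i 1) (weight U q i) := by
  have : action (q := q) hU (mk U q (FreeAlgebra.ι K (i, true))) =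
      FreeAlgebra.lift K (generatorAction U q) (FreeAlgebra.ι K (i, true)) :=
    RingQuot.liftAlgHom_mkAlgHom_apply K _ _ _
  rw [FreeAlgebra.lift_ι_apply] at this
  exact this

/-- Ordered monomials act on the functions on the exponents by weighted shifts. -/
theorem exists_action_monomial (hU : U.transpose = -U) (k m : Fin p → ℤ) :
    ∃ c : Kˣ, action hU (monomial U q k) (Finsupp.single m 1) = c • Finsupp.single (m + k) 1 := by
  let P : (QuantumTorus U q)ˣ → (Fin p → ℤ) → Prop := fun t d =>
    ∀ m, ∃ c : Kˣ, action hU (t : QuantumTorus U q) (Finsupp.single m 1) =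
      c • Finsupp.single (m + d) 1
  have hone : P 1 0 := fun m => ⟨1, by simp⟩
  have hmul : ∀ s t d e, P s d → P t e → P (s * t) (d + e) := by
    intro s t d e hs ht m
    obtain ⟨c, hc⟩ := ht m
    obtain ⟨c', hc'⟩ := hs (m + e)
    refine ⟨c * c', ?_⟩
    rw [Units.val_mul, map_mul, Module.End.mul_apply, hc, Units.smul_def, map_smul, hc',
      ← Units.smul_def, smul_smul, add_assoc, add_comm e]
  have hinv : ∀ t d, P t d → P t⁻¹ (-d) := by
    intro t d ht m
    obtain ⟨c, hc⟩ := ht (m + -d)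
    rw [neg_add_cancel_right] at hc
    refine ⟨c⁻¹, ?_⟩
    have h1 : Finsupp.single m (1 : K) = action hU (t : QuantumTorus U q)
        (c⁻¹ • Finsupp.single (m + -d) 1) := by
      rw [Units.smul_def, map_smul, hc, ← Units.smul_def, smul_smul, inv_mul_cancel, one_smul]
    rw [h1, ← Module.End.mul_apply, ← map_mul, Units.inv_mul, map_one, Module.End.one_apply]
  have hx : ∀ i, P (x U q i) (Pi.single i 1) := by
    intro i m
    refine ⟨weight U q i m, ?_⟩
    rw [action_x, weightedShift_single, Units.smul_def, Finsupp.smul_single, smul_eq_mul, mul_comm]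
  have hzpow : ∀ t d, P t d → ∀ a : ℤ, P (t ^ a) (a • d) := by
    intro t d ht
    have hpow : ∀ n : ℕ, P (t ^ n) (n • d) := by
      intro n
      induction n with
      | zero => simpa using hone
      | succ n ih => rw [pow_succ, succ_nsmul]; exact hmul _ _ _ _ ih ht
    rintro (n | n)
    · simpa using hpow n
    · rw [zpow_negSucc, negSucc_zsmul]
      exact hinv _ _ (hpow _)
  have hlist : ∀ l : List (Fin p),
      P (listMonomial U q l k) (l.map fun i => k i • Pi.single i (1 : ℤ)).sum := by
    intro l
    induction l with
    | nil => exact hone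
    | cons i l ih =>
      rw [listMonomial_cons, List.map_cons, List.sum_cons]
      exact hmul _ _ _ _ (hzpow _ _ (hx i) _) ih
  have h1 := hlist (List.finRange p)
  have h2 : ((List.finRange p).map fun i => k i • Pi.single i (1 : ℤ)).sum = k := by
    rw [← Fin.sum_univ_def]
    conv_rhs => rw [← Finset.univ_sum_single k]
    refine Finset.sum_congr rfl fun i _ => ?_
    rw [← Pi.single_smul, smul_eq_mul, mul_one]
  rw [h2] at h1
  exact h1 m

/-- Acting on the basis vector at exponent `0` sends distinct monomials to nonzero multiples of
distinct basis vectors. -/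
theorem linearIndependent_monomial (hU : U.transpose = -U) :
    LinearIndependent K (monomial U q) := by
  choose c hc using fun k => exists_action_monomial (q := q) hU k 0
  let f : QuantumTorus U q →ₗ[K] ((Fin p → ℤ) →₀ K) :=
    (LinearMap.applyₗ (Finsupp.single (0 : Fin p → ℤ) (1 : K))).comp (action hU).toLinearMap
  refine LinearIndependent.of_comp f ?_
  have h1 := (Finsupp.basisSingleOne (R := K) (ι := Fin p → ℤ)).linearIndependent.units_smul c
  convert h1 using 1
  ext1 k
  rw [Pi.smul_apply', Finsupp.coe_basisSingleOne]
  refine (hc k).trans ?_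
  rw [zero_add]

/-- The basis of ordered monomials of the quantum torus. -/
noncomputable def monomialBasis (hU : U.transpose = -U) :
    Module.Basis (Fin p → ℤ) K (QuantumTorus U q) :=
  Module.Basis.mk (linearIndependent_monomial hU) span_monomial.ge

theorem monomialBasis_apply (hU : U.transpose = -U) (k : Fin p → ℤ) :
    monomialBasis (q := q) hU k = monomial U q k :=
  Module.Basis.mk_apply _ _ k

theorem exists_isTwistedBasis (hU : U.transpose = -U) {N : ℕ} (hq : q ^ N = 1) :
    ∃ β : (Fin p → ℤ) → (Fin p → ℤ) → Kˣ, IsTwistedBasis (monomialBasis (q := q) hU) β N := by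
  obtain ⟨B, hB⟩ := exists_monomial_mul (U := U) (q := q)
  refine ⟨fun k l => q ^ B k l, fun k l => ?_, fun k k' l => ?_, fun k l l' => ?_, fun k l => ?_⟩
  · simp only [monomialBasis_apply, hB]
  · rw [map_add, AddMonoidHom.add_apply, zpow_add]
  · rw [map_add, zpow_add]
  · rw [← zpow_natCast, ← zpow_mul, mul_comm, zpow_mul, zpow_natCast, hq, one_zpow]

theorem monomialSubalgebra_eq (hU : U.transpose = -U) (qHalf : Kˣ)
    {β : (Fin p → ℤ) → (Fin p → ℤ) → Kˣ} {N : ℕ}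
    (h : IsTwistedBasis (monomialBasis (q := q) hU) β N) (Λ : AddSubmonoid (Fin p → ℤ)) :
    monomialSubalgebra U q qHalf Λ = h.monomials Λ := by
  apply Subalgebra.toSubmodule_injective
  change Submodule.span K _ = Submodule.span K _
  apply le_antisymm <;> rw [Submodule.span_le] <;> rintro _ ⟨k, hk, rfl⟩ <;>
    obtain ⟨c, hc⟩ := X_eq_smul_monomial (U := U) (q := q) qHalf k
  · rw [hc, ← monomialBasis_apply hU]
    exact Submodule.smul_mem _ (c : K) (Submodule.subset_span ⟨k, hk, rfl⟩)
  · have h1 : monomialBasis (q := q) hU k = c⁻¹ • X U q qHalf k := by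
      rw [hc, monomialBasis_apply, smul_smul, inv_mul_cancel, one_smul]
    rw [h1]
    exact Submodule.smul_mem _ ((c⁻¹ : Kˣ) : K) (Submodule.subset_span ⟨k, hk, rfl⟩)

end QuantumTorus

/-! ### Convexity: `Λ` as the lattice points of its group in half-spaces. -/

/-- Finitely many positive reals can be kept positive by a `ℚ`-linear map from their span to `ℚ`. -/
theorem exists_rat_linear_pos (s : Finset ℝ) (hs : ∀ r ∈ s, 0 < r) :
    ∃ φ : Submodule.span ℚ (s : Set ℝ) →ₗ[ℚ] ℚ,
      ∀ (r : ℝ) (hr : r ∈ s), 0 < φ ⟨r, Submodule.subset_span hr⟩ := by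
  classical
  let V := Submodule.span ℚ (s : Set ℝ)
  have : Module.Finite ℚ V := inferInstance
  let b := Module.finBasis ℚ V
  -- `O` collects the values on the basis `b` for which the extended map is positive on `s`. The
  -- inclusion `V ⊆ ℝ` gives a real point of this open set, so it also has a rational point.
  let O : Set (Fin (Module.finrank ℚ V) → ℝ) :=
    ⋂ r : s, {w | 0 < ∑ i, (b.repr ⟨r, Submodule.subset_span r.2⟩ i : ℝ) * w i}
  have hO : IsOpen O := isOpen_iInter_of_finite fun r =>
    isOpen_lt continuous_const (by fun_prop)
  have hne : O.Nonempty := by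
    refine ⟨fun i => (b i : ℝ), Set.mem_iInter.mpr fun r => ?_⟩
    have h1 := congrArg (V.subtype) (b.sum_repr ⟨r, Submodule.subset_span r.2⟩)
    rw [map_sum] at h1
    simp only [map_smul, Submodule.subtype_apply, Rat.smul_def] at h1
    exact (hs r r.2).trans_eq h1.symm
  have hdense : DenseRange (Pi.map fun (_ : Fin (Module.finrank ℚ V)) (t : ℚ) => (t : ℝ)) :=
    DenseRange.piMap fun _ => Rat.denseRange_cast
  obtain ⟨w, hw⟩ := hdense.exists_mem_open hO hne
  refine ⟨b.constr ℚ w, fun r hr => ?_⟩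
  have h1 : 0 < ∑ i, (b.repr ⟨r, Submodule.subset_span hr⟩ i : ℝ) * (w i : ℝ) :=
    Set.mem_iInter.mp hw ⟨r, hr⟩
  rw [Module.Basis.constr_apply_fintype]
  simp only [Module.Basis.equivFun_apply, smul_eq_mul]
  exact_mod_cast h1

/-- A conic combination with real coefficients becomes one with positive rational coefficients under
`exists_rat_linear_pos`; clearing denominators gives a multiple of `k` in `Λ`. -/
theorem exists_nsmul_mem_of_mem_latticeCone {p : ℕ} {Λ : AddSubmonoid (Fin p → ℤ)}
    {k : Fin p → ℤ} (hk : (fun i => (k i : ℝ)) ∈ latticeCone Λ) :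
    ∃ c : ℕ, 0 < c ∧ c • k ∈ Λ := by
  classical
  rw [latticeCone] at hk
  obtain ⟨l, hl, hlk⟩ := (Finsupp.mem_span_image_iff_linearCombination _).mp hk
  rw [Finsupp.mem_supported] at hl
  -- Including `1` makes the coefficient `a = φ 1` of `k` positive as well.
  let s : Finset ℝ := insert 1 (l.support.image fun m => (l m : ℝ))
  have hs : ∀ r ∈ s, 0 < r := by
    intro r hr
    rcases Finset.mem_insert.mp hr with rfl | hr
    · exact one_pos
    · obtain ⟨m, hm, rfl⟩ := Finset.mem_image.mp hr
      exact lt_of_le_of_ne (l m).2 fun h0 =>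
        Finsupp.mem_support_iff.mp hm (Subtype.ext h0.symm)
  obtain ⟨φ, hφ⟩ := exists_rat_linear_pos s hs
  let v : ∀ r : ℝ, r ∈ s → Submodule.span ℚ (s : Set ℝ) := fun r hr =>
    ⟨r, Submodule.subset_span hr⟩
  have h1s : (1 : ℝ) ∈ s := Finset.mem_insert_self _ _
  have hms : ∀ m : l.support, (l m : ℝ) ∈ s := fun m =>
    Finset.mem_insert_of_mem (Finset.mem_image_of_mem _ m.2)
  let a : ℚ := φ (v 1 h1s)
  let r : l.support → ℚ := fun m => φ (v _ (hms m))
  have ha : 0 < a := hφ 1 h1s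
  have hr : ∀ m, 0 < r m := fun m => hφ _ (hms m)
  have heq : ∀ i, a * k i = ∑ m : l.support, r m * (m : Fin p → ℤ) i := by
    intro i
    have h1 : (k i : ℝ) = ∑ m : l.support, (l m : ℝ) * ((m : Fin p → ℤ) i : ℝ) := by
      have := congrFun hlk i
      rw [Finsupp.linearCombination_apply, Finsupp.sum, Finset.sum_apply] at this
      rw [← this, ← Finset.sum_coe_sort]
      rfl
    have h2 : (k i : ℤ) • v 1 h1s = ∑ m : l.support, ((m : Fin p → ℤ) i) • v _ (hms m) := by
      apply Submodule.subtype_injective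
      rw [map_zsmul, map_sum]
      simp only [map_zsmul, Submodule.subtype_apply, v, zsmul_eq_mul, mul_one]
      rw [h1]
      exact Finset.sum_congr rfl fun m _ => mul_comm _ _
    have h3 := congrArg φ h2
    rw [map_sum, map_zsmul] at h3
    simp only [map_zsmul, zsmul_eq_mul] at h3
    rw [mul_comm, h3]
    exact Finset.sum_congr rfl fun m _ => mul_comm _ _
  let D : ℕ := a.den * ∏ m : l.support, (r m).den
  have hD : 0 < D := Nat.mul_pos a.den_pos (Finset.prod_pos fun m _ => (r m).den_pos)
  have hnat : ∀ t : ℚ, 0 < t → t.den ∣ D → ∃ n : ℕ, (D : ℚ) * t = n ∧ 0 < n := by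
    intro t ht hdvd
    obtain ⟨e, he⟩ := hdvd
    have h0 : 0 < t.num := Rat.num_pos.mpr ht
    have h1 : (D : ℚ) * t = ((e * t.num.toNat : ℕ) : ℚ) := by
      have h2 : ((t.num.toNat : ℕ) : ℚ) = t.num := by exact_mod_cast Int.toNat_of_nonneg h0.le
      rw [he]
      push_cast
      rw [h2]
      have h3 : (t.den : ℚ) * t = t.num := Rat.den_mul_eq_num t
      rw [mul_right_comm, h3, mul_comm]
    refine ⟨_, h1, ?_⟩
    have : (0 : ℚ) < D * t := by positivity
    rw [h1] at this
    exact_mod_cast this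
  obtain ⟨c, hc, hc0⟩ := hnat a ha (Dvd.intro _ rfl)
  choose n hn hn0 using fun m : l.support => hnat (r m) (hr m)
    (Dvd.dvd.mul_left (Finset.dvd_prod_of_mem (fun m => (r m).den) (Finset.mem_univ m)) _)
  refine ⟨c, hc0, ?_⟩
  have hck : c • k = ∑ m : l.support, n m • (m : Fin p → ℤ) := by
    ext i
    rw [Finset.sum_apply]
    simp only [Pi.smul_apply, nsmul_eq_mul]
    have h1 : ((c : ℚ) * k i) = ∑ m : l.support, (n m : ℚ) * (m : Fin p → ℤ) i := by
      rw [← hc, mul_assoc, heq, Finset.mul_sum]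
      exact Finset.sum_congr rfl fun m _ => by rw [← hn, mul_assoc]
    exact_mod_cast h1
  rw [hck]
  exact Λ.sum_mem fun m _ => Λ.nsmul_mem (hl m.2) _

/-- A primitive submonoid with closed cone is cut out of the group it generates by half-spaces. -/
theorem mem_of_forall_nonneg {p : ℕ} {Λ : AddSubmonoid (Fin p → ℤ)}
    (hclosed : IsClosed (latticeCone Λ : Set (Fin p → ℝ))) (hprim : IsPrimitiveSubmonoid Λ)
    {k : Fin p → ℤ} (hk : k ∈ AddSubgroup.closure (Λ : Set (Fin p → ℤ)))
    (hf : ∀ f : (Fin p → ℤ) →+ ℝ, (∀ l ∈ Λ, 0 ≤ f l) → 0 ≤ f k) : k ∈ Λ := by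
  let ι : (Fin p → ℤ) →+ (Fin p → ℝ) :=
    AddMonoidHom.mk' (fun k i => (k i : ℝ)) (fun a b => by ext; simp)
  suffices h : ι k ∈ latticeCone Λ by
    obtain ⟨c, hc, hck⟩ := exists_nsmul_mem_of_mem_latticeCone h
    exact hprim c hc k hk hck
  by_contra hnot
  -- Otherwise Hahn–Banach separates `k` from the closed cone by a functional nonnegative on `Λ` and
  -- negative at `k`.
  let C : ProperCone ℝ (Fin p → ℝ) := ⟨latticeCone Λ, hclosed⟩
  obtain ⟨f, hfC, hfk⟩ := C.hyperplane_separation_point hnot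
  have := hf ((f : (Fin p → ℝ) →+ ℝ).comp ι) fun l hl =>
    hfC _ (Submodule.subset_span ⟨l, hl, rfl⟩)
  exact absurd hfk (not_lt.mpr this)

/-! ### Reduction of maximality to ideals of numerators. -/

namespace CentralLocalization

variable {A : Type*} [Ring A]

/-- Nonzero central elements are regular on the domain `A`, so `A` embeds in its central
localization, where `1 ⊗ z` is invertible. -/
theorem tmul_right_injective [IsDomain A] (z : FractionRing (Subring.center A)) (hz : z ≠ 0) :
    Function.Injective fun a : A => a ⊗ₜ[Subring.center A] z := by
  have : IsDomain (Subring.center A) := inferInstance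
  let F := FractionRing (Subring.center A)
  have h1 : Function.Injective fun a : A => a ⊗ₜ[Subring.center A] (1 : F) := by
    intro a b hab
    have h2 : (1 : F) ⊗ₜ[Subring.center A] a = 1 ⊗ₜ b := by
      have := congrArg (TensorProduct.comm (Subring.center A) A F) hab
      simpa using this
    obtain ⟨c, hc⟩ := (IsLocalizedModule.eq_iff_exists (nonZeroDivisors (Subring.center A))
      (TensorProduct.mk (Subring.center A) F A 1)).mp h2
    have h3 : (c : Subring.center A) ≠ 0 := nonZeroDivisors.ne_zero c.2
    have h4 : ((c : Subring.center A) : A) ≠ 0 := fun h => h3 (Subtype.ext h)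
    exact mul_left_cancel₀ h4 hc
  intro a b hab
  refine h1 ?_
  have := congrArg (fun t => t * ((1 : A) ⊗ₜ[Subring.center A] z⁻¹)) hab
  simpa [Algebra.TensorProduct.tmul_mul_tmul, mul_inv_cancel₀ hz] using this

variable (B : Subring (CentralLocalization A)) (z : nonZeroDivisors (Subring.center A))

/-- The numerators of the elements of `B` with denominator `z`. -/
def numerators : AddSubgroup A where
  carrier := {a |
    a ⊗ₜ[Subring.center A] IsLocalization.mk' (FractionRing (Subring.center A)) 1 z ∈ B}
  zero_mem' := by
    change _ ∈ B
    rw [TensorProduct.zero_tmul]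
    exact B.zero_mem
  add_mem' := fun {a b} ha hb => by
    change _ ∈ B
    rw [TensorProduct.add_tmul]
    exact B.add_mem ha hb
  neg_mem' := fun {a} ha => by
    change _ ∈ B
    rw [TensorProduct.neg_tmul]
    exact B.neg_mem ha

variable {B z}

theorem mul_mem_numerators (hB : (of A).range ≤ B) (a : A) {b : A} (hb : b ∈ numerators B z) :
    a * b ∈ numerators B z := by
  have := B.mul_mem (hB ⟨a, rfl⟩) hb
  change (a ⊗ₜ[Subring.center A] (1 : FractionRing (Subring.center A))) * _ ∈ B at this
  rwa [Algebra.TensorProduct.tmul_mul_tmul, one_mul] at this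

theorem numerators_mul_mem (hB : (of A).range ≤ B) (a : A) {b : A} (hb : b ∈ numerators B z) :
    b * a ∈ numerators B z := by
  have := B.mul_mem hb (hB ⟨a, rfl⟩)
  change _ * (a ⊗ₜ[Subring.center A] (1 : FractionRing (Subring.center A))) ∈ B at this
  rwa [Algebra.TensorProduct.tmul_mul_tmul, mul_one] at this

theorem tmul_mk' (a : A) : (((z : Subring.center A) : A) * a) ⊗ₜ[Subring.center A]
    IsLocalization.mk' (FractionRing (Subring.center A)) 1 z = of A a := by
  change ((z : Subring.center A) • a) ⊗ₜ[Subring.center A] _ = a ⊗ₜ 1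
  rw [TensorProduct.smul_tmul, Algebra.smul_def, mul_comm, IsLocalization.mk'_spec, map_one]

/-- The product of `z⁻¹a` and `z⁻¹b` lies in `B ⊆ z⁻¹A`, so `z⁻²ab = z⁻¹c`; injectivity brings this
back to `A`. -/
theorem exists_numerators_mul [IsDomain A]
    (hB : (B : Set (CentralLocalization A)) ⊆ fractions z) {a b : A}
    (ha : a ∈ numerators B z) (hb : b ∈ numerators B z) :
    ∃ c ∈ numerators B z, a * b = (z : Subring.center A) * c := by
  have h1 := B.mul_mem ha hb
  rw [Algebra.TensorProduct.tmul_mul_tmul] at h1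
  obtain ⟨c, hc⟩ := hB h1
  refine ⟨c, ?_, ?_⟩
  · change _ ∈ B
    rwa [← hc] at h1
  · have : IsDomain (Subring.center A) := inferInstance
    let w := IsLocalization.mk' (FractionRing (Subring.center A)) 1 z
    have hw : algebraMap _ (FractionRing (Subring.center A)) (z : Subring.center A) * w = 1 := by
      rw [mul_comm, IsLocalization.mk'_spec, map_one]
    have hw0 : w * w ≠ 0 := by
      have : w ≠ 0 := right_ne_zero_of_mul_eq_one hw
      exact mul_ne_zero this this
    refine tmul_right_injective _ hw0 ?_
    change _ = ((z : Subring.center A) • c) ⊗ₜ[Subring.center A] (w * w)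
    rw [TensorProduct.smul_tmul, Algebra.smul_def, ← mul_assoc, hw, one_mul]
    exact hc.symm

/-- A criterion for maximal orders in terms of the numerators. -/
theorem isMaximalOrder_of_forall [IsDomain A]
    (h : ∀ (I : AddSubgroup A) (z : A), z ∈ Subring.center A → z ≠ 0 →
    (∀ a, ∀ b ∈ I, a * b ∈ I) → (∀ a, ∀ b ∈ I, b * a ∈ I) →
    (∀ a ∈ I, ∀ b ∈ I, ∃ c ∈ I, a * b = z * c) → ∀ a ∈ I, ∃ b, a = z * b) :
    IsMaximalOrder A where
  isDomain := inferInstance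
  eq_of_le := by
    intro B z hAB hBz
    refine le_antisymm (fun b hb => ?_) hAB
    obtain ⟨a, rfl⟩ := hBz hb
    have hz0 : ((z : Subring.center A) : A) ≠ 0 := fun h0 =>
      nonZeroDivisors.ne_zero z.2 (Subtype.ext h0)
    obtain ⟨b, rfl⟩ := h (numerators B z) z (z : Subring.center A).2 hz0
      (fun a b hb => mul_mem_numerators hAB a hb) (fun a b hb => numerators_mul_mem hAB a hb)
      (fun a ha b hb => exists_numerators_mul hBz ha hb) a hb
    exact ⟨b, (tmul_mk' b).symm⟩

end CentralLocalization

/-! ### Conclusion for monomial algebras. -/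

namespace IsTwistedBasis

variable {K T G : Type*} [Field K] [Ring T] [Algebra K T] [AddCommGroup G]
  {Y : Module.Basis G K T} {β : G → G → Kˣ} {N : ℕ}

theorem isMaximalOrder_monomials [UniqueSums G] [Module.Free ℤ G] [Module.Finite ℤ G]
    (h : IsTwistedBasis Y β N) (hN : (N : K) ≠ 0) {Λ : AddSubmonoid G}
    (hΛ : ∀ k ∈ AddSubgroup.closure (Λ : Set G),
      (∀ f : G →+ ℝ, (∀ l ∈ Λ, 0 ≤ f l) → 0 ≤ f k) → k ∈ Λ) :
    IsMaximalOrder (h.monomials Λ) := by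
  have := h.noZeroDivisors
  have : Nontrivial T := ⟨⟨Y 0, 0, Y.ne_zero 0⟩⟩
  have : NoZeroDivisors (h.monomials Λ) :=
    Subtype.val_injective.noZeroDivisors _ rfl fun _ _ => rfl
  have : IsDomain (h.monomials Λ) := NoZeroDivisors.to_isDomain _
  refine CentralLocalization.isMaximalOrder_of_forall fun I z hzc hz0 hl hr hI a ha => ?_
  -- Scalars lie in the monomial algebra, so an ideal is automatically a `K`-subspace.
  let I' : Submodule K T :=
    { carrier := {x | ∃ y ∈ I, (y : T) = x}
      zero_mem' := ⟨0, I.zero_mem, rfl⟩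
      add_mem' := by
        rintro _ _ ⟨x, hx, rfl⟩ ⟨y, hy, rfl⟩
        exact ⟨x + y, I.add_mem hx hy, rfl⟩
      smul_mem' := by
        rintro c _ ⟨x, hx, rfl⟩
        refine ⟨c • x, ?_, rfl⟩
        rw [Algebra.smul_def]
        exact hl _ x hx }
  obtain ⟨b, hb, hab⟩ := h.exists_eq_mul_of_mul_subset hN hΛ (I := I') (z := z) (x := a)
    (by rintro _ ⟨x, -, rfl⟩; exact x.2)
    (by
      rintro l hlΛ _ ⟨x, hx, rfl⟩
      exact ⟨_, hl ⟨Y l, h.basis_mem_monomials hlΛ⟩ x hx, rfl⟩)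
    (by
      rintro l hlΛ _ ⟨x, hx, rfl⟩
      exact ⟨_, hr ⟨Y l, h.basis_mem_monomials hlΛ⟩ x hx, rfl⟩)
    (fun h0 => hz0 (Subtype.ext h0)) z.2
    (fun l hlΛ => congrArg Subtype.val
      (Subring.mem_center_iff.mp hzc ⟨Y l, h.basis_mem_monomials hlΛ⟩).symm)
    (by
      rintro _ ⟨x, hx, rfl⟩ _ ⟨y, hy, rfl⟩
      obtain ⟨w, hw, hxy⟩ := hI x hx y hy
      exact ⟨w, ⟨w, hw, rfl⟩, congrArg Subtype.val hxy⟩)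
    ⟨a, ha, rfl⟩
  exact ⟨⟨b, hb⟩, Subtype.ext hab⟩

/-- The scalars and the monomials `Y (N • m)`, `m ∈ Λ`, are central, and over them the monomials
from `exists_finset_span` generate. -/
theorem finite_center_monomials (h : IsTwistedBasis Y β N) (hN : N ≠ 0) {Λ : AddSubmonoid G}
    (hfg : Λ.FG) : Module.Finite (Subring.center (h.monomials Λ)) (h.monomials Λ) := by
  classical
  obtain ⟨F, hFΛ, hF⟩ := h.exists_finset_span hN hfg
  let A := h.monomials Λ
  let g : F → A := fun l => ⟨Y l, h.basis_mem_monomials (hFΛ l l.2)⟩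
  let M : Submodule (Subring.center A) A := Submodule.span _ (Set.range g)
  have hcenter : ∀ x : A, (∀ y : A, (y : T) * x = x * y) → x ∈ Subring.center A := fun x hx =>
    Subring.mem_center_iff.mpr fun y => Subtype.ext (hx y)
  refine ⟨Submodule.fg_def.mpr ⟨_, Set.finite_range g, eq_top_iff.mpr ?_⟩⟩
  rintro ⟨x, hx⟩ -
  change _ ∈ M
  have key : ∀ x ∈ Submodule.span K (Y '' (Λ : Set G)), ∃ y ∈ M, (y : T) = x := by
    intro x hx
    induction hx using Submodule.span_induction with
    | mem x hx =>
      obtain ⟨k, hk, rfl⟩ := hx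
      obtain ⟨m, hm, l, hl, hkl⟩ := hF k hk
      let c : Subring.center A := ⟨⟨Y (N • m), h.basis_mem_monomials (Λ.nsmul_mem hm N)⟩,
        hcenter _ fun y => (h.commute_nsmul m y).eq.symm⟩
      exact ⟨_, M.smul_mem c (Submodule.subset_span ⟨⟨l, hl⟩, rfl⟩), hkl.symm⟩
    | zero => exact ⟨0, M.zero_mem, rfl⟩
    | add x y _ _ hx hy =>
      obtain ⟨x, hx, rfl⟩ := hx
      obtain ⟨y, hy, rfl⟩ := hy
      exact ⟨x + y, M.add_mem hx hy, rfl⟩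
    | smul a x _ hx =>
      obtain ⟨x, hx, rfl⟩ := hx
      let c : Subring.center A := ⟨algebraMap K A a, hcenter _ fun y =>
        (Algebra.commutes a (y : T)).symm⟩
      refine ⟨c • x, M.smul_mem c hx, ?_⟩
      exact (Algebra.smul_def a (x : T)).symm
  obtain ⟨y, hy, rfl⟩ := key x hx
  exact hy

end IsTwistedBasis

theorem proposition3p7p5 {p : ℕ} (U : Matrix (Fin p) (Fin p) ℤ) (hU : U.transpose = -U)
    (N : ℕ) (hN : 0 < N) (ξ : ℂˣ) (hξ : IsPrimitiveRoot ξ N)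
    (ξHalf : ℂˣ) (hξHalf : ξHalf ^ 2 = ξ)
    (Λ : AddSubmonoid (Fin p → ℤ))
    (hclosed : IsClosed (latticeCone Λ : Set (Fin p → ℝ)))
    (hprim : IsPrimitiveSubmonoid Λ) :
    IsMaximalOrder (QuantumTorus.monomialSubalgebra U ξ ξHalf Λ) ∧
      (Λ.FG →
        Module.Finite (Subring.center (QuantumTorus.monomialSubalgebra U ξ ξHalf Λ))
          (QuantumTorus.monomialSubalgebra U ξ ξHalf Λ)) := by
  obtain ⟨β, h⟩ := QuantumTorus.exists_isTwistedBasis hU hξ.pow_eq_one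
  rw [QuantumTorus.monomialSubalgebra_eq hU ξHalf h]
  exact ⟨h.isMaximalOrder_monomials (Nat.cast_ne_zero.mpr hN.ne')
    fun _ => mem_of_forall_nonneg hclosed hprim, h.finite_center_monomials hN.ne'⟩
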